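/- Let $d\in\{2,3\}$, let $\Omega\subset\mathbb R^d$ be a bounded domain (nonempty, open, connected) with $C^\infty$ boundary $\Gamma$, and let $\Omega_0\subset\Omega$ be open. Let the source space $P$ be either $L^2(\Omega_0)$ or $H^1(\Omega_0)$ (real-valued functions, with the usual norms), let $\mathbf H^1(\Omega)$ be the complex Sobolev space, and let the damping parameter $\eta:[0,\infty)\to(0,\infty)$ be continuous. For real-valued boundary data $g_1^\delta,g_2^\delta\in L^\infty(\Gamma)$ and an initial pair $(p_0,\dot p_0)\in P\times P$ consider the coupled system for $p^\delta(x,t)$ (real) and $u(x,t),w(x,t)$ (complex, $i=\sqrt{-1}$, with imaginary parts $u_{im},w_{im}$): $$\ddot p^\delta+\eta(t)\,\dot p^\delta+w_{im}=0\ \text{ in }\Omega_0,\ t>0,\qquad p^\delta(\cdot,0)=p_0,\quad \dot p^\delta(\cdot,0)=\dot p_0,$$ $$-\Delta w+w=u_{im}\ \text{ in }\Omega,\qquad \frac{\partial w}{\partial\mathbf n}+i\,w=0\ \text{ on }\Gamma,\qquad t>0,$$ $$-\Delta u+u=p^\delta\chi_{\Omega_0}\ \text{ in }\Omega,\qquad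 \frac{\partial u}{\partial\mathbf n}+i\,u=g_2^\delta+i\,g_1^\delta\ \text{ on }\Gamma,\qquad t>0.$$ A global weak solution is a triple $(p^\delta,u,w)$ such that $p^\delta:[0,\infty)\to P$ is continuously differentiable on $[0,\infty)$ and twice differentiable on $(0,\infty)$ (derivatives in the norm of $P$) and satisfies the first line, the differential equation holding a.e. in $\Omega_0$ for every $t>0$; and, for every $t>0$, $u(\cdot,t),w(\cdot,t)\in\mathbf H^1(\Omega)$ are weak solutions of the two boundary value problems. Here $y\in\mathbf H^1(\Omega)$ is a weak solution of $-\Delta y+y=f$ in $\Omega$, $\partial y/\partial\mathbf n+i\,y=g$ on $\Gamma$, if $$\int_\Omega(\nabla y\cdot\nabla\bar\psi+y\bar\psi)\,dx+i\int_\Gamma y\bar\psi\,ds=\int_\Omega f\bar\psi\,dx+\int_\Gamma g\bar\psi\,ds\qquad\text{for all }\psi\in\mathbf H^1(\Omega),$$ with boundary values in the sense of traces. Then for each pair $(p_0,\dot p_0)\in P\times P$ and all $g_1^\delta,g_2^\delta\in L^\infty(\Gamma)$ the system has a unique global weak solution. This solution depends continuously on the boundary data: for fixed $(p_0,\dot p_0)$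 and fixed data $(g_1^\delta,g_2^\delta)$, for every $T>0$ and $\varepsilon>0$ there is a $\rho>0$ such that, whenever $h_1,h_2\in L^\infty(\Gamma)$ satisfy $\|h_j-g_j^\delta\|_{L^2(\Gamma)}<\rho$ for $j=1,2$, the solutions $(p^\delta,u,w)$ for $(g_1^\delta,g_2^\delta)$ and $(\tilde p,\tilde u,\tilde w)$ for $(h_1,h_2)$ with the same initial pair satisfy $\|\tilde p(t)-p^\delta(t)\|_P<\varepsilon$ and $\|\dot{\tilde p}(t)-\dot p^\delta(t)\|_P<\varepsilon$ for $0\le t\le T$, and $\|\tilde u(t)-u(t)\|_{\mathbf H^1(\Omega)}<\varepsilon$ and $\|\tilde w(t)-w(t)\|_{\mathbf H^1(\Omega)}<\varepsilon$ for $0<t\le T$. -/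

import Mathlib

open MeasureTheory Set Filter Topology

noncomputable section

/-- The Euclidean space `ℝ^d`. -/
abbrev Euc (d : ℕ) : Type := EuclideanSpace ℝ (Fin d)

/-- The classical partial derivative `∂φ/∂xᵢ`. -/
def classicalPartial {d : ℕ} {F : Type*} [NormedAddCommGroup F] [NormedSpace ℝ F]
    (i : Fin d) (φ : Euc d → F) (x : Euc d) : F :=
  fderiv ℝ φ x (EuclideanSpace.single i (1 : ℝ))

/-- A bounded domain (nonempty connected open set) of `ℝ^d` with `C^∞` boundary: near every
boundary point it is the strict sublevel set `{ρ < 0}` of a smooth function `ρ` whose differential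
does not vanish at that point. -/
structure IsSmoothBoundedDomain {d : ℕ} (Ω : Set (Euc d)) : Prop where
  isOpen : IsOpen Ω
  isConnected : IsConnected Ω
  isBounded : Bornology.IsBounded Ω
  smooth_boundary : ∀ x ∈ frontier Ω, ∃ (U : Set (Euc d)) (ρ : Euc d → ℝ),
    IsOpen U ∧ x ∈ U ∧ ContDiff ℝ (⊤ : ℕ∞) ρ ∧ fderiv ℝ ρ x ≠ 0 ∧ Ω ∩ U = {y ∈ U | ρ y < 0}

/-- The surface measure on `Γ = ∂Ω`: the `(d-1)`-dimensional Hausdorff measure on `Γ`, with the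
Euclidean normalization (a unit cube of dimension `d-1` has measure one). -/
def surfaceMeasure {d : ℕ} (Ω : Set (Euc d)) : Measure (Euc d) :=
  (Measure.euclideanHausdorffMeasure (d - 1)).restrict (frontier Ω)

/-- `v` is the `i`-th weak partial derivative of `u` on the open set `G`. -/
def IsWeakPartial {d : ℕ} {𝕜 : Type*} [RCLike 𝕜] (G : Set (Euc d)) (i : Fin d)
    (u v : Euc d → 𝕜) : Prop :=
  ∀ φ : Euc d → ℝ, ContDiff ℝ (⊤ : ℕ∞) φ → HasCompactSupport φ → tsupport φ ⊆ G →
    ∫ x in G, ((classicalPartial i φ x : ℝ) : 𝕜) * u x = - ∫ x in G, ((φ x : ℝ) : 𝕜) * v x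

/-- `L²(G)`. -/
abbrev LTwo (𝕜 : Type*) [RCLike 𝕜] {d : ℕ} (G : Set (Euc d)) : Type _ :=
  Lp 𝕜 2 ((volume : Measure (Euc d)).restrict G)

/-- `L²(G) × L²(G)^d` with its Hilbert norm. -/
abbrev LTwoJet (𝕜 : Type*) [RCLike 𝕜] {d : ℕ} (G : Set (Euc d)) : Type _ :=
  WithLp 2 (LTwo 𝕜 G × PiLp 2 (fun _ : Fin d => LTwo 𝕜 G))

section aux

variable {d : ℕ} {𝕜 : Type*} [RCLike 𝕜]

theorem integrable_ofReal_mul_lTwo (G : Set (Euc d)) (ψ : Euc d → ℝ) (hc : Continuous ψ)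
    (hs : HasCompactSupport ψ) (u : LTwo 𝕜 G) :
    Integrable (fun x => ((ψ x : ℝ) : 𝕜) * u x) ((volume : Measure (Euc d)).restrict G) := by
  have h1 : MemLp (fun x => ((ψ x : ℝ) : 𝕜)) 2 ((volume : Measure (Euc d)).restrict G) :=
    (hc.memLp_of_hasCompactSupport hs).ofReal
  exact h1.integrable_mul (Lp.memLp u)

theorem continuous_classicalPartial (i : Fin d) {φ : Euc d → ℝ}
    (h : ContDiff ℝ (⊤ : ℕ∞) φ) : Continuous (classicalPartial i φ) := by
  have h2 : Continuous (fderiv ℝ φ) := h.continuous_fderiv (by simp)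
  exact h2.clm_apply continuous_const

theorem hasCompactSupport_classicalPartial (i : Fin d) {φ : Euc d → ℝ}
    (h : HasCompactSupport φ) : HasCompactSupport (classicalPartial i φ) :=
  h.fderiv_apply (𝕜 := ℝ) (EuclideanSpace.single i (1 : ℝ))

theorem isWeakPartial_zero (G : Set (Euc d)) (i : Fin d) :
    IsWeakPartial G i ((0 : LTwo 𝕜 G) : Euc d → 𝕜) ((0 : LTwo 𝕜 G) : Euc d → 𝕜) := by
  intro φ _ _ _
  have h := Lp.coeFn_zero 𝕜 2 ((volume : Measure (Euc d)).restrict G)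
  rw [integral_eq_zero_of_ae, integral_eq_zero_of_ae, neg_zero]
  · filter_upwards [h] with x hx
    rw [hx, Pi.zero_apply, mul_zero]
  · filter_upwards [h] with x hx
    rw [hx, Pi.zero_apply, mul_zero]

theorem isWeakPartial_add {G : Set (Euc d)} {i : Fin d} {u v u' v' : LTwo 𝕜 G}
    (h : IsWeakPartial G i u v) (h' : IsWeakPartial G i u' v') :
    IsWeakPartial G i ((u + u' : LTwo 𝕜 G) : Euc d → 𝕜) ((v + v' : LTwo 𝕜 G) : Euc d → 𝕜) := by
  intro φ hφ hc hs
  have key : ∀ (ψ : Euc d → ℝ), Continuous ψ → HasCompactSupport ψ → ∀ a b : LTwo 𝕜 G,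
      ∫ x in G, ((ψ x : ℝ) : 𝕜) * ((a + b : LTwo 𝕜 G) : Euc d → 𝕜) x =
        (∫ x in G, ((ψ x : ℝ) : 𝕜) * a x) + ∫ x in G, ((ψ x : ℝ) : 𝕜) * b x := by
    intro ψ h1 h2 a b
    rw [← integral_add (integrable_ofReal_mul_lTwo G ψ h1 h2 a)
      (integrable_ofReal_mul_lTwo G ψ h1 h2 b)]
    refine integral_congr_ae ?_
    filter_upwards [Lp.coeFn_add a b] with x hx
    rw [hx, Pi.add_apply, mul_add]
  rw [key _ (continuous_classicalPartial i hφ) (hasCompactSupport_classicalPartial i hc),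
    key φ hφ.continuous hc, h φ hφ hc hs, h' φ hφ hc hs]
  ring

theorem isWeakPartial_smul {G : Set (Euc d)} {i : Fin d} {u v : LTwo 𝕜 G} (c : 𝕜)
    (h : IsWeakPartial G i u v) :
    IsWeakPartial G i ((c • u : LTwo 𝕜 G) : Euc d → 𝕜) ((c • v : LTwo 𝕜 G) : Euc d → 𝕜) := by
  intro φ hφ hc hs
  have key : ∀ (ψ : Euc d → ℝ) (a : LTwo 𝕜 G),
      ∫ x in G, ((ψ x : ℝ) : 𝕜) * ((c • a : LTwo 𝕜 G) : Euc d → 𝕜) x =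
        c * ∫ x in G, ((ψ x : ℝ) : 𝕜) * a x := by
    intro ψ a
    rw [← integral_const_mul]
    refine integral_congr_ae ?_
    filter_upwards [Lp.coeFn_smul c a] with x hx
    rw [hx, Pi.smul_apply, smul_eq_mul]
    ring
  rw [key, key, h φ hφ hc hs]
  ring

end aux

/-- The Sobolev space `H¹(G)` of an open set `G`: the functions of `L²(G)` with weak first partial
derivatives in `L²(G)`. An element is stored as the pair `(u, ∇u)`, so that the norm is
`(‖u‖² + ∑ᵢ ‖∂ᵢu‖²)^(1/2)`. `𝕜 = ℝ` gives the real space and `𝕜 = ℂ` the complex one. -/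
def SobolevH1 (𝕜 : Type*) [RCLike 𝕜] {d : ℕ} (G : Set (Euc d)) : Submodule 𝕜 (LTwoJet 𝕜 G) where
  carrier := {U | ∀ i : Fin d, IsWeakPartial G i (U.fst : Euc d → 𝕜) (U.snd i : Euc d → 𝕜)}
  zero_mem' := fun i => isWeakPartial_zero G i
  add_mem' := fun ha hb i => isWeakPartial_add (ha i) (hb i)
  smul_mem' := fun c _ ha i => isWeakPartial_smul c (ha i)

/-- The function underlying an element of `H¹(G)`. -/
def h1Val {𝕜 : Type*} [RCLike 𝕜] {d : ℕ} {G : Set (Euc d)} (u : SobolevH1 𝕜 G) : Euc d → 𝕜 :=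
  (u.1.fst : Euc d → 𝕜)

/-- The weak partial derivative `∂ᵢu` of an element of `H¹(G)`. -/
def h1Partial {𝕜 : Type*} [RCLike 𝕜] {d : ℕ} {G : Set (Euc d)} (i : Fin d)
    (u : SobolevH1 𝕜 G) : Euc d → 𝕜 :=
  (u.1.snd i : Euc d → 𝕜)

/-- `τ ∈ L²(Γ)` is the boundary trace of `u ∈ H¹(Ω)`: there are functions `φₙ`, smooth up to the
boundary, with `φₙ → u` in `H¹(Ω)` and `φₙ|Γ → τ` in `L²(Γ)`. On a smooth bounded domain every
`u ∈ H¹(Ω)` has exactly one trace, and `u ↦ τ` is the usual trace operator. -/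
def IsTrace {d : ℕ} {Ω : Set (Euc d)} (u : SobolevH1 ℂ Ω) (τ : Lp ℂ 2 (surfaceMeasure Ω)) :
    Prop :=
  ∃ φ : ℕ → Euc d → ℂ, (∀ n, ContDiff ℝ (⊤ : ℕ∞) (φ n)) ∧
    Tendsto (fun n => eLpNorm (fun x => φ n x - h1Val u x) 2 (volume.restrict Ω)) atTop (𝓝 0) ∧
    (∀ i : Fin d, Tendsto (fun n => eLpNorm (fun x => classicalPartial i (φ n) x - h1Partial i u x)
      2 (volume.restrict Ω)) atTop (𝓝 0)) ∧
    Tendsto (fun n => eLpNorm (fun x => φ n x - τ x) 2 (surfaceMeasure Ω)) atTop (𝓝 0)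

/-- The sesquilinear form `a(u,ψ) = ∫_Ω (∇u · ∇ψ̄ + u ψ̄) dx + i ∫_Γ u ψ̄ ds`, where `τu` and `τψ`
are the traces of `u` and `ψ`. -/
def ccbmForm {d : ℕ} {Ω : Set (Euc d)} (u ψ : SobolevH1 ℂ Ω)
    (τu τψ : Lp ℂ 2 (surfaceMeasure Ω)) : ℂ :=
  (∫ x in Ω, ((∑ i : Fin d, h1Partial i u x * (starRingEnd ℂ) (h1Partial i ψ x))
      + h1Val u x * (starRingEnd ℂ) (h1Val ψ x)))
    + Complex.I * ∫ x, τu x * (starRingEnd ℂ) (τψ x) ∂(surfaceMeasure Ω)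

/-- `u ∈ H¹(Ω)` is a weak solution of `-Δu + u = f` in `Ω`, `∂u/∂n + i u = g` on `Γ`:
`a(u,ψ) = ∫_Ω f ψ̄ dx + ∫_Γ g ψ̄ ds` for all `ψ ∈ H¹(Ω)`. -/
def IsWeakRobinSolution {d : ℕ} (Ω : Set (Euc d)) (f g : Euc d → ℂ) (u : SobolevH1 ℂ Ω) : Prop :=
  ∃ τu : Lp ℂ 2 (surfaceMeasure Ω), IsTrace u τu ∧
    ∀ (ψ : SobolevH1 ℂ Ω) (τψ : Lp ℂ 2 (surfaceMeasure Ω)), IsTrace ψ τψ →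
      ccbmForm u ψ τu τψ = (∫ x in Ω, f x * (starRingEnd ℂ) (h1Val ψ x))
        + ∫ x, g x * (starRingEnd ℂ) (τψ x) ∂(surfaceMeasure Ω)

/-- `(p, u, w)`, with velocity `v = ṗ`, is a global weak solution of the coupled system
* `p̈ + η(t) ṗ + Im w = 0` in `Ω₀`, `t > 0`, with `p(0) = p₀` and `ṗ(0) = v₀`;
* `-Δw + w = Im u` in `Ω`, `∂w/∂n + i w = 0` on `Γ`, for every `t > 0`;
* `-Δu + u = p χ_{Ω₀}` in `Ω`, `∂u/∂n + i u = g₂ + i g₁` on `Γ`, for every `t > 0`.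

Here `P` is the source space and `val q` is the function on `Ω₀` given by `q ∈ P`. The curve `p` is
continuously differentiable from `[0,∞)` to `P` and twice differentiable on `(0,∞)`, with
derivatives taken in the norm of `P`; the boundary value problems hold in the weak sense. -/
structure IsGlobalWeakSolution {d : ℕ} {P : Type*} [NormedAddCommGroup P] [NormedSpace ℝ P]
    (val : P → Euc d → ℝ) (Ω Ω₀ : Set (Euc d)) (η : ℝ → ℝ) (g₁ g₂ : Euc d → ℝ) (p₀ v₀ : P)
    (p v : ℝ → P) (u w : ℝ → SobolevH1 ℂ Ω) : Prop where
  hasDeriv : ∀ t ∈ Ici (0 : ℝ), HasDerivWithinAt p (v t) (Ici 0) t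
  continuous_velocity : ContinuousOn v (Ici 0)
  initial_position : p 0 = p₀
  initial_velocity : v 0 = v₀
  evolution : ∀ t ∈ Ioi (0 : ℝ), ∃ a : P, HasDerivAt v a t ∧
    ∀ᵐ x ∂((volume : Measure (Euc d)).restrict Ω₀),
      val a x + η t * val (v t) x + (h1Val (w t) x).im = 0
  adjoint : ∀ t ∈ Ioi (0 : ℝ),
    IsWeakRobinSolution Ω (fun x => (((h1Val (u t) x).im : ℝ) : ℂ)) (fun _ => 0) (w t)
  state : ∀ t ∈ Ioi (0 : ℝ),
    IsWeakRobinSolution Ω (Ω₀.indicator fun x => ((val (p t) x : ℝ) : ℂ))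
      (fun x => (g₂ x : ℂ) + Complex.I * (g₁ x : ℂ)) (u t)

/-- For the source space `P` and all initial pairs in `P × P`:
* for all boundary data in `L^∞(Γ)` the coupled system has exactly one global weak solution;
* the solution depends continuously on the boundary data: if the data converge in `L²(Γ)`, then
  `p` and `ṗ` converge in `P`, and `u` and `w` in `H¹(Ω)`, uniformly on bounded time intervals. -/
def SystemWellPosed {d : ℕ} {P : Type*} [NormedAddCommGroup P] [NormedSpace ℝ P]
    (val : P → Euc d → ℝ) (Ω Ω₀ : Set (Euc d)) (η : ℝ → ℝ) : Prop :=
  ∀ p₀ v₀ : P, ∀ g₁ g₂ : Euc d → ℝ,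
    MemLp g₁ ⊤ (surfaceMeasure Ω) → MemLp g₂ ⊤ (surfaceMeasure Ω) →
    (∃ (p v : ℝ → P) (u w : ℝ → SobolevH1 ℂ Ω),
      IsGlobalWeakSolution val Ω Ω₀ η g₁ g₂ p₀ v₀ p v u w ∧
      ∀ (p' v' : ℝ → P) (u' w' : ℝ → SobolevH1 ℂ Ω),
        IsGlobalWeakSolution val Ω Ω₀ η g₁ g₂ p₀ v₀ p' v' u' w' →
          (∀ t ∈ Ici (0 : ℝ), p' t = p t ∧ v' t = v t) ∧
          (∀ t ∈ Ioi (0 : ℝ), u' t = u t ∧ w' t = w t)) ∧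
    (∀ T > (0 : ℝ), ∀ ε > (0 : ℝ), ∃ δ > (0 : ℝ), ∀ h₁ h₂ : Euc d → ℝ,
      MemLp h₁ ⊤ (surfaceMeasure Ω) → MemLp h₂ ⊤ (surfaceMeasure Ω) →
      eLpNorm (fun x => h₁ x - g₁ x) 2 (surfaceMeasure Ω) < ENNReal.ofReal δ →
      eLpNorm (fun x => h₂ x - g₂ x) 2 (surfaceMeasure Ω) < ENNReal.ofReal δ →
      ∀ (p v p' v' : ℝ → P) (u w u' w' : ℝ → SobolevH1 ℂ Ω),
        IsGlobalWeakSolution val Ω Ω₀ η g₁ g₂ p₀ v₀ p v u w →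
        IsGlobalWeakSolution val Ω Ω₀ η h₁ h₂ p₀ v₀ p' v' u' w' →
          (∀ t ∈ Icc (0 : ℝ) T, ‖p' t - p t‖ < ε ∧ ‖v' t - v t‖ < ε) ∧
          (∀ t ∈ Ioc (0 : ℝ) T, ‖u' t - u t‖ < ε ∧ ‖w' t - w t‖ < ε))

end

/-! At each time the two boundary value problems can be solved for `u` and `w`. They give `u = S p +
b` and `w = W u`, with `S`, `W` bounded and real-linear and `b` linear and bounded in the boundary
data. If `R` denotes the imaginary part restricted to `Ω₀`, then `p` satisfies `p̈ + η ṗ + K p + k =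
0` in `P`, where `K = R W S` is bounded and `k = R W b`. Since `w ∈ H¹(Ω)`, the operator `R` maps
into `H¹(Ω₀)` as well as into `L²(Ω₀)`, so one argument serves both source spaces. The remaining
equation is a linear ODE in a Banach space: a contraction in an exponentially weighted norm gives a
global solution, and Gronwall's inequality gives uniqueness and Lipschitz dependence on `k`.

The Robin problems are solved by `IsSmoothBoundedDomain.exists_robinSolver`. The unknown there is a
pair (function, trace) in `traceGraph`, a closed subspace of `H¹(Ω) × L²(Γ)`. In the product norm
the form `⟪u, ψ⟫ + i⟪τ, σ⟫` is coercive at once, because its real and imaginary parts on the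
diagonal are the two squared norms. Hence neither a trace inequality nor existence and uniqueness of
traces is needed. Smoothness of `Γ` enters through the finiteness of the surface measure. -/

/-! ### Finiteness of the surface measure -/

/-- The level set of a strictly differentiable function is, near a regular point, mapped to the
kernel of the differential by an antilipschitz projection. -/
theorem HasStrictFDerivAt.exists_antilipschitz_levelSet {E : Type*} [NormedAddCommGroup E]
    [InnerProductSpace ℝ E] [FiniteDimensional ℝ E] {ρ : E → ℝ} {ρ' : E →L[ℝ] ℝ} {x : E}
    (h : HasStrictFDerivAt ρ ρ' x) :
    ∃ K : NNReal, ∃ P : E →L[ℝ] ρ'.ker, ∃ s ∈ 𝓝 x,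
      AntilipschitzWith K (fun y : ↥(s ∩ {y | ρ y = 0}) => P (y : E)) := by
  let P : E →L[ℝ] ρ'.ker := ρ'.ker.orthogonalProjectionOnto
  have hker : (LinearMap.prod (ρ' : E →ₗ[ℝ] ℝ) (P : E →ₗ[ℝ] ρ'.ker)).ker = ⊥ := by
    refine LinearMap.ker_eq_bot'.2 fun y hy => ?_
    have h1 : ρ' y = 0 := congrArg Prod.fst hy
    have h2 : P y = 0 := congrArg Prod.snd hy
    have h3 : P ((⟨y, h1⟩ : ρ'.ker) : E) = ⟨y, h1⟩ :=
      Submodule.orthogonalProjectionOnto_mem_subspace_eq_self _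
    have h4 : (⟨y, h1⟩ : ρ'.ker) = 0 := h3.symm.trans h2
    exact congrArg Subtype.val h4
  obtain ⟨K, hK0, hK⟩ := LinearMap.exists_antilipschitzWith _ hker
  have hKpos : (0 : ℝ) < K := hK0
  -- With this constant, `K‖ρ'(y - z)‖ ≤ ‖y - z‖ / 2` on the level set. So `ρ'` cannot realize the
  -- maximum in the product norm unless `y = z`, and the projection alone controls the distance.
  have hev := h.isLittleO.def (c := ((K : ℝ) * 2)⁻¹) (by positivity)
  obtain ⟨s, hs, hsP⟩ := Filter.eventually_prod_self_iff (r := fun a b : E =>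
    ‖ρ a - ρ b - ρ' (a - b)‖ ≤ ((K : ℝ) * 2)⁻¹ * ‖a - b‖) |>.1 (by rwa [nhds_prod_eq] at hev)
  refine ⟨K, P, s, hs, AntilipschitzWith.of_le_mul_dist fun y z => ?_⟩
  have hyz := hsP y y.2.1 z z.2.1
  have hy : ρ y = 0 := y.2.2
  have hz : ρ z = 0 := z.2.2
  simp only [hy, hz, sub_self, zero_sub, norm_neg] at hyz
  have hd := hK.le_mul_dist (y : E) (z : E)
  rw [dist_eq_norm, dist_eq_norm, ← map_sub] at hd
  rw [Subtype.dist_eq, dist_eq_norm, dist_eq_norm, ← map_sub]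
  rw [Prod.norm_def] at hd
  rcases le_total ‖P ((y : E) - z)‖ ‖ρ' ((y : E) - z)‖ with hle | hle
  · have e : max ‖(LinearMap.prod (ρ' : E →ₗ[ℝ] ℝ) (P : E →ₗ[ℝ] ρ'.ker) ((y : E) - z)).1‖
        ‖(LinearMap.prod (ρ' : E →ₗ[ℝ] ℝ) (P : E →ₗ[ℝ] ρ'.ker) ((y : E) - z)).2‖
        = ‖ρ' ((y : E) - z)‖ := max_eq_left hle
    rw [e] at hd
    have h5 : (K : ℝ) * ‖ρ' ((y : E) - z)‖ ≤ K * (((K : ℝ) * 2)⁻¹ * ‖(y : E) - z‖) := by gcongr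
    have h6 : (K : ℝ) * (((K : ℝ) * 2)⁻¹ * ‖(y : E) - z‖) = ‖(y : E) - z‖ / 2 := by field_simp
    have h7 : ‖(y : E) - z‖ ≤ 0 := by linarith
    exact h7.trans (by positivity)
  · have e : max ‖(LinearMap.prod (ρ' : E →ₗ[ℝ] ℝ) (P : E →ₗ[ℝ] ρ'.ker) ((y : E) - z)).1‖
        ‖(LinearMap.prod (ρ' : E →ₗ[ℝ] ℝ) (P : E →ₗ[ℝ] ρ'.ker) ((y : E) - z)).2‖
        = ‖P ((y : E) - z)‖ := max_eq_right hle
    rwa [e] at hd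

/-- Near a regular point the level set has finite Hausdorff measure of codimension one. -/
theorem HasStrictFDerivAt.finiteAtFilter_levelSet {E : Type*} [NormedAddCommGroup E]
    [InnerProductSpace ℝ E] [FiniteDimensional ℝ E] [MeasurableSpace E] [BorelSpace E]
    {ρ : E → ℝ} {ρ' : E →L[ℝ] ℝ} {x : E}
    (h : HasStrictFDerivAt ρ ρ' x) (hρ' : ρ' ≠ 0) :
    ∃ s ∈ 𝓝 x, (Measure.euclideanHausdorffMeasure (Module.finrank ℝ E - 1) : Measure E)
      (s ∩ {y | ρ y = 0}) < ⊤ := by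
  obtain ⟨K, P, s, hs, hP⟩ := h.exists_antilipschitz_levelSet
  have hfin : Module.finrank ℝ E - 1 = Module.finrank ℝ ρ'.ker := by
    have := Module.Dual.finrank_ker_add_one_of_ne_zero (f := (ρ' : E →ₗ[ℝ] ℝ))
      (fun h0 => hρ' (ContinuousLinearMap.coe_injective h0))
    change Module.finrank ℝ ρ'.ker + 1 = _ at this
    omega
  -- The ball makes the projected set bounded in the kernel, where Hausdorff measure of full
  -- dimension is finite on bounded sets.
  refine ⟨s ∩ Metric.ball x 1, inter_mem hs (Metric.ball_mem_nhds x one_pos), ?_⟩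
  rw [Measure.euclideanHausdorffMeasure_def, Measure.smul_apply, hfin, ENNReal.smul_def, smul_eq_mul]
  refine ENNReal.mul_lt_top ENNReal.coe_lt_top ?_
  set n := Module.finrank ℝ ρ'.ker
  let S : Set ↥(s ∩ {y | ρ y = 0}) := Subtype.val ⁻¹' Metric.ball x 1
  have himg : s ∩ Metric.ball x 1 ∩ {y | ρ y = 0} = Subtype.val '' S := by
    rw [Subtype.image_preimage_coe]
    ext y
    simp only [mem_inter_iff]
    tauto
  rw [himg, isometry_subtype_coe.hausdorffMeasure_image (Or.inl (Nat.cast_nonneg n))]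
  refine (hP.le_hausdorffMeasure_image (Nat.cast_nonneg n) S).trans_lt ?_
  refine ENNReal.mul_lt_top (ENNReal.rpow_lt_top_of_nonneg (Nat.cast_nonneg n) (by simp)) ?_
  have hb : Bornology.IsBounded (P '' Metric.ball x 1) :=
    P.lipschitz.isBounded_image Metric.isBounded_ball
  refine lt_of_le_of_lt (measure_mono (t := P '' Metric.ball x 1) ?_) hb.measure_lt_top
  rintro _ ⟨y, hy, rfl⟩
  exact ⟨y, hy, rfl⟩

/-- `Γ` is compact, so finiteness is a local matter, and near each of its points `Γ` lies in a
regular level set. This puts smooth functions and `L^∞` data into `L²(Γ)`. -/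
theorem IsSmoothBoundedDomain.isFiniteMeasure_surfaceMeasure {d : ℕ} {Ω : Set (Euc d)}
    (hΩ : IsSmoothBoundedDomain Ω) : IsFiniteMeasure (surfaceMeasure Ω) := by
  have hcomp : IsCompact (frontier Ω) :=
    (Metric.isCompact_of_isClosed_isBounded isClosed_closure hΩ.isBounded.closure).of_isClosed_subset
      isClosed_frontier frontier_subset_closure
  refine ⟨?_⟩
  rw [surfaceMeasure, Measure.restrict_apply_univ]
  refine hcomp.measure_lt_top_of_nhdsWithin fun x hx => ?_
  obtain ⟨U, ρ, hU, hxU, hρ, hρ', hΩU⟩ := hΩ.smooth_boundary x hx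
  have hstrict : HasStrictFDerivAt ρ (fderiv ℝ ρ x) x :=
    hρ.contDiffAt.hasStrictFDerivAt (by simp)
  obtain ⟨s, hs, hfin⟩ := hstrict.finiteAtFilter_levelSet hρ'
  rw [finrank_euclideanSpace_fin] at hfin
  have hzero : ∀ y ∈ U ∩ frontier Ω, ρ y = 0 := by
    rintro y ⟨hyU, hy⟩
    have hle : ρ y ≤ 0 := by
      have h1 : y ∈ closure (Ω ∩ U) := hU.closure_inter ⟨frontier_subset_closure hy, hyU⟩
      have h2 : closure (Ω ∩ U) ⊆ {z | ρ z ≤ 0} := by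
        refine closure_minimal (fun z hz => ?_) (isClosed_le hρ.continuous continuous_const)
        rw [hΩU] at hz
        exact hz.2.le
      exact h2 h1
    have hge : ¬ ρ y < 0 := by
      intro hlt
      have : y ∈ Ω ∩ U := by rw [hΩU]; exact ⟨hyU, hlt⟩
      rw [hΩ.isOpen.frontier_eq] at hy
      exact hy.2 this.1
    exact le_antisymm hle (not_lt.1 hge)
  have hsub : frontier Ω ∩ (s ∩ U) ⊆ s ∩ {y | ρ y = 0} :=
    fun y hy => ⟨hy.2.1, hzero y ⟨hy.2.2, hy.1⟩⟩
  exact ⟨frontier Ω ∩ (s ∩ U), inter_mem_nhdsWithin _ (inter_mem hs (hU.mem_nhds hxU)),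
    (measure_mono hsub).trans_lt hfin⟩

/-! ### Global solutions of Lipschitz ODEs in Banach spaces -/

/-- With the weight `Λ(t) = ∫₀ᵗ 2M`, a function bounded by `C M e^Λ` has a primitive bounded by
`C e^Λ / 2`. -/
theorem norm_exp_neg_smul_integral_le {E : Type*} [NormedAddCommGroup E] [NormedSpace ℝ E]
    {M : ℝ → ℝ} (hM : Continuous M) {f : ℝ → E} {C : ℝ} (hC : 0 ≤ C) {t : ℝ}
    (ht : 0 ≤ t)
    (hf : ∀ s ∈ Icc 0 t, ‖f s‖ ≤ C * (M s * Real.exp (∫ r in (0 : ℝ)..s, 2 * M r))) :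
    ‖Real.exp (-∫ r in (0 : ℝ)..t, 2 * M r) • ∫ s in (0 : ℝ)..t, f s‖ ≤ C / 2 := by
  set Λ : ℝ → ℝ := fun s => ∫ r in (0 : ℝ)..s, 2 * M r with hΛ
  have hcont : Continuous fun r => 2 * M r := continuous_const.mul hM
  have hder : ∀ s, HasDerivAt Λ (2 * M s) s := fun s =>
    intervalIntegral.integral_hasDerivAt_right (hcont.intervalIntegrable _ _)
      hcont.stronglyMeasurable.stronglyMeasurableAtFilter hcont.continuousAt
  have hΛc : Continuous Λ := continuous_iff_continuousAt.2 fun s => (hder s).continuousAt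
  have hgc : Continuous fun s => C * (M s * Real.exp (Λ s)) := by fun_prop
  have h1 : ‖∫ s in (0 : ℝ)..t, f s‖ ≤ ∫ s in (0 : ℝ)..t, C * (M s * Real.exp (Λ s)) :=
    intervalIntegral.norm_integral_le_of_norm_le ht
      (Filter.Eventually.of_forall fun s hs => hf s ⟨hs.1.le, hs.2⟩)
      (hgc.intervalIntegrable _ _)
  have h2 : ∫ s in (0 : ℝ)..t, C * (M s * Real.exp (Λ s))
      = C / 2 * Real.exp (Λ t) - C / 2 * Real.exp (Λ 0) := by
    refine intervalIntegral.integral_eq_sub_of_hasDerivAt (f := fun s => C / 2 * Real.exp (Λ s))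
      (fun s _ => ?_) (hgc.intervalIntegrable _ _)
    have hd := (hder s).exp.const_mul (C / 2)
    have e : C / 2 * (Real.exp (Λ s) * (2 * M s)) = C * (M s * Real.exp (Λ s)) := by ring
    rwa [e] at hd
  rw [norm_smul, Real.norm_of_nonneg (Real.exp_pos _).le, Real.exp_neg]
  have hpos := Real.exp_pos (Λ t)
  have h3 : ‖∫ s in (0 : ℝ)..t, f s‖ ≤ C / 2 * Real.exp (Λ t) := by
    have : 0 ≤ C / 2 * Real.exp (Λ 0) := by positivity
    linarith
  rw [inv_mul_le_iff₀ hpos]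
  linarith

/-- Global existence for `x' = F(t, x)` when `F` is continuous and Lipschitz in `x` with a
constant depending continuously on `t`. -/
theorem exists_global_hasDerivAt_of_lipschitz {E : Type*} [NormedAddCommGroup E]
    [NormedSpace ℝ E] [CompleteSpace E] {F : ℝ → E → E} (hF : Continuous (Function.uncurry F))
    {m : ℝ → ℝ} (hm : Continuous m) (hLip : ∀ t x y, ‖F t x - F t y‖ ≤ m t * ‖x - y‖) (x₀ : E) :
    ∃ x : ℝ → E, x 0 = x₀ ∧ ∀ t, 0 ≤ t → HasDerivAt x (F t (x t)) t := by
  -- The Lipschitz constant yields the contraction; the term `‖F t 0‖` keeps the weighted iterates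
  -- bounded.
  let M : ℝ → ℝ := fun t => |m t| + ‖F t 0‖
  have hM : Continuous M := by
    have : Continuous fun t => F t 0 := hF.comp (continuous_id.prodMk continuous_const)
    fun_prop
  have hM0 : ∀ t, 0 ≤ M t := fun t => by positivity
  let Λ : ℝ → ℝ := fun s => ∫ r in (0 : ℝ)..s, 2 * M r
  have hcont : Continuous fun r => 2 * M r := continuous_const.mul hM
  have hΛc : Continuous Λ :=
    intervalIntegral.continuous_primitive (fun a b => hcont.intervalIntegrable a b) 0
  have hΛ0 : ∀ s, 0 ≤ s → 0 ≤ Λ s := fun s hs =>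
    intervalIntegral.integral_nonneg hs fun r _ => by have := hM0 r; positivity
  -- The unknown is `y = e^(-Λ) x`: the sup norm of `y` is the weighted norm of `x`, in which the
  -- Picard map has constant `1/2` on the whole half-line.
  let f : BoundedContinuousFunction ℝ E → ℝ → E := fun y s => F s (Real.exp (Λ s) • y s)
  have hfc : ∀ y, Continuous (f y) := fun y =>
    hF.comp (continuous_id.prodMk ((Real.continuous_exp.comp hΛc).smul y.continuous))
  have hfprim : ∀ y t, HasDerivAt (fun t => x₀ + ∫ s in (0 : ℝ)..t, f y s) (f y t) t := fun y t =>
    (intervalIntegral.integral_hasDerivAt_right ((hfc y).intervalIntegrable _ _)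
      (hfc y).stronglyMeasurable.stronglyMeasurableAtFilter (hfc y).continuousAt).const_add x₀
  have hfpc : ∀ y, Continuous (fun t => x₀ + ∫ s in (0 : ℝ)..t, f y s) := fun y =>
    continuous_iff_continuousAt.2 fun t => (hfprim y t).continuousAt
  let g : BoundedContinuousFunction ℝ E → ℝ → E := fun y t =>
    Real.exp (-Λ t) • (x₀ + ∫ s in (0 : ℝ)..t, f y s)
  have hgc : ∀ y, Continuous (g y) := fun y =>
    (Real.continuous_exp.comp hΛc.neg).smul (hfpc y)
  have hbound : ∀ y t, 0 ≤ t → ‖g y t‖ ≤ ‖x₀‖ + (‖y‖ + 1) / 2 := by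
    intro y t ht
    simp only [g, smul_add]
    refine (norm_add_le _ _).trans (add_le_add ?_ ?_)
    · rw [norm_smul, Real.norm_of_nonneg (Real.exp_pos _).le]
      exact mul_le_of_le_one_left (norm_nonneg _) (Real.exp_le_one_iff.2 (by linarith [hΛ0 t ht]))
    · refine norm_exp_neg_smul_integral_le hM (by positivity) ht fun s hs => ?_
      have h1 : ‖f y s‖ ≤ m s * ‖Real.exp (Λ s) • y s - 0‖ + ‖F s 0‖ := by
        have := hLip s (Real.exp (Λ s) • y s) 0
        have h2 := norm_le_norm_sub_add (F s (Real.exp (Λ s) • y s)) (F s 0)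
        exact h2.trans (by gcongr)
      have h3 : 1 ≤ Real.exp (Λ s) := Real.one_le_exp (hΛ0 s hs.1)
      rw [sub_zero, norm_smul, Real.norm_of_nonneg (Real.exp_pos _).le] at h1
      have h4 : m s * (Real.exp (Λ s) * ‖y s‖) ≤ |m s| * (Real.exp (Λ s) * ‖y‖) := by
        gcongr
        · exact le_abs_self _
        · exact y.norm_coe_le_norm s
      have h5 : ‖F s 0‖ * 1 ≤ ‖F s 0‖ * Real.exp (Λ s) := by gcongr
      have h6 : 0 ≤ |m s| * Real.exp (Λ s) := by positivity
      have h7 : 0 ≤ ‖F s 0‖ * Real.exp (Λ s) * ‖y‖ := by positivity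
      change ‖f y s‖ ≤ (‖y‖ + 1) * ((|m s| + ‖F s 0‖) * Real.exp (Λ s))
      nlinarith
  -- The estimates hold for `t ≥ 0` only, so the image is frozen at its value at `0` for negative
  -- times.
  let T : BoundedContinuousFunction ℝ E → BoundedContinuousFunction ℝ E := fun y =>
    BoundedContinuousFunction.ofNormedAddCommGroup (fun t => g y (max t 0))
      ((hgc y).comp (continuous_id.max continuous_const)) _
      fun t => hbound y (max t 0) (le_max_right _ _)
  have hT : ContractingWith (1 / 2) T := by
    refine ⟨by norm_num, LipschitzWith.of_dist_le_mul fun y z => ?_⟩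
    refine (BoundedContinuousFunction.dist_le (by positivity)).2 fun t => ?_
    have ht : (0 : ℝ) ≤ max t 0 := le_max_right _ _
    change dist (g y (max t 0)) (g z (max t 0)) ≤ _
    generalize max t 0 = t at ht
    have e : g y t - g z t = Real.exp (-Λ t) • ∫ s in (0 : ℝ)..t, (f y s - f z s) := by
      rw [intervalIntegral.integral_sub ((hfc y).intervalIntegrable _ _)
        ((hfc z).intervalIntegrable _ _), ← smul_sub]
      congr 1
      abel
    rw [dist_eq_norm, e]
    have h0 := norm_exp_neg_smul_integral_le hM (f := fun s => f y s - f z s) (C := dist y z)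
      dist_nonneg ht fun s hs => ?_
    · refine h0.trans (le_of_eq ?_)
      simp only [NNReal.coe_div, NNReal.coe_one, NNReal.coe_ofNat]
      ring
    · have h1 := hLip s (Real.exp (Λ s) • y s) (Real.exp (Λ s) • z s)
      rw [← smul_sub, norm_smul, Real.norm_of_nonneg (Real.exp_pos _).le] at h1
      rw [← dist_eq_norm (y s)] at h1
      have h4 : m s * (Real.exp (Λ s) * dist (y s) (z s)) ≤ M s * (Real.exp (Λ s) * dist y z) := by
        have : m s ≤ M s := (le_abs_self _).trans (le_add_of_nonneg_right (norm_nonneg _))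
        have := hM0 s
        gcongr
        exact BoundedContinuousFunction.dist_coe_le_dist s
      refine h1.trans (h4.trans (le_of_eq ?_))
      change _ = dist y z * (M s * Real.exp (Λ s))
      ring
  obtain ⟨y, hy⟩ : ∃ y, T y = y := ⟨_, hT.fixedPoint_isFixedPt⟩
  refine ⟨fun t => x₀ + ∫ s in (0 : ℝ)..t, f y s, by simp, fun t ht => ?_⟩
  have hyt : y t = g y t := by
    have : T y t = g y (max t 0) := rfl
    rw [hy, max_eq_left ht] at this
    exact this
  convert hfprim y t using 1
  simp only [f]
  rw [hyt, smul_smul, ← Real.exp_add, add_neg_cancel, Real.exp_zero, one_smul]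

/-! ### Completeness of `H¹` and the trace graph -/

/-- A compactly supported continuous function is in `L²`, so testing against it is an inner product.
This makes each instance of the weak derivative identity a closed condition. -/
theorem exists_testFunctional {d : ℕ} {𝕜 : Type*} [RCLike 𝕜] (G : Set (Euc d)) {ψ : Euc d → ℝ}
    (hc : Continuous ψ) (hs : HasCompactSupport ψ) :
    ∃ L : LTwo 𝕜 G →L[𝕜] 𝕜, ∀ a : LTwo 𝕜 G, L a = ∫ x in G, ((ψ x : ℝ) : 𝕜) * a x := by
  have h1 : MemLp (fun x => ((ψ x : ℝ) : 𝕜)) 2 ((volume : Measure (Euc d)).restrict G) :=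
    (hc.memLp_of_hasCompactSupport hs).ofReal
  refine ⟨innerSL 𝕜 h1.toLp, fun a => ?_⟩
  rw [innerSL_apply_apply, L2.inner_def]
  refine integral_congr_ae ?_
  filter_upwards [h1.coeFn_toLp] with x hx
  rw [hx, RCLike.inner_apply, RCLike.conj_ofReal, mul_comm]

theorem isClosed_sobolevH1 {d : ℕ} (𝕜 : Type*) [RCLike 𝕜] (G : Set (Euc d)) :
    IsClosed (SobolevH1 𝕜 G : Set (LTwoJet 𝕜 G)) := by
  have e : (SobolevH1 𝕜 G : Set (LTwoJet 𝕜 G)) =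
      {U | ∀ i : Fin d, IsWeakPartial G i (U.fst : Euc d → 𝕜) (U.snd i : Euc d → 𝕜)} := rfl
  rw [e]
  simp only [IsWeakPartial, ofPred_forall]
  refine isClosed_iInter fun i => isClosed_iInter fun φ => isClosed_iInter fun hφ =>
    isClosed_iInter fun hc => isClosed_iInter fun _ => ?_
  obtain ⟨L, hL⟩ := exists_testFunctional (𝕜 := 𝕜) G (continuous_classicalPartial i hφ)
    (hasCompactSupport_classicalPartial i hc)
  obtain ⟨L', hL'⟩ := exists_testFunctional (𝕜 := 𝕜) G hφ.continuous hc
  simp only [← hL, ← hL']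
  refine isClosed_eq (L.continuous.comp (WithLp.fstL 2 𝕜 _ _).continuous)
    (L'.continuous.comp ?_).neg
  exact (PiLp.proj (𝕜 := 𝕜) 2 (fun _ : Fin d => LTwo 𝕜 G) i).continuous.comp
    (WithLp.sndL 2 𝕜 _ _).continuous

instance {d : ℕ} {𝕜 : Type*} [RCLike 𝕜] {G : Set (Euc d)} : CompleteSpace (SobolevH1 𝕜 G) :=
  (isClosed_sobolevH1 𝕜 G).completeSpace_coe

/-- A function of `H¹(Ω)` together with a function of `L²(Γ)`, forgetting the weak
differentiability. -/
abbrev JetWithBoundary {d : ℕ} (Ω : Set (Euc d)) : Type :=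
  WithLp 2 (LTwoJet ℂ Ω × Lp ℂ 2 (surfaceMeasure Ω))

theorem classicalPartial_add {d : ℕ} (i : Fin d) {φ ψ : Euc d → ℂ}
    (hφ : ContDiff ℝ (⊤ : ℕ∞) φ) (hψ : ContDiff ℝ (⊤ : ℕ∞) ψ) (x : Euc d) :
    classicalPartial i (φ + ψ) x = classicalPartial i φ x + classicalPartial i ψ x := by
  unfold classicalPartial
  rw [fderiv_add (hφ.differentiable (by simp) x) (hψ.differentiable (by simp) x)]
  rfl

theorem classicalPartial_const_smul {d : ℕ} (i : Fin d) (c : ℂ) {φ : Euc d → ℂ}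
    (hφ : ContDiff ℝ (⊤ : ℕ∞) φ) (x : Euc d) :
    classicalPartial i (c • φ) x = c * classicalPartial i φ x := by
  unfold classicalPartial
  rw [fderiv_const_smul (hφ.differentiable (by simp) x)]
  rfl

theorem continuous_classicalPartial_complex {d : ℕ} (i : Fin d) {φ : Euc d → ℂ}
    (h : ContDiff ℝ (⊤ : ℕ∞) φ) : Continuous (classicalPartial i φ) :=
  (h.continuous_fderiv (by simp)).clm_apply continuous_const

/-- The jets and boundary values of the functions that are smooth up to the boundary. -/
def smoothJets {d : ℕ} (Ω : Set (Euc d)) : Submodule ℂ (JetWithBoundary Ω) where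
  carrier := {p | ∃ φ : Euc d → ℂ, ContDiff ℝ (⊤ : ℕ∞) φ ∧
    (p.fst.fst : Euc d → ℂ) =ᵐ[volume.restrict Ω] φ ∧
    (∀ i, (p.fst.snd i : Euc d → ℂ) =ᵐ[volume.restrict Ω] classicalPartial i φ) ∧
    (p.snd : Euc d → ℂ) =ᵐ[surfaceMeasure Ω] φ}
  zero_mem' := by
    refine ⟨0, contDiff_const, Lp.coeFn_zero _ _ _, fun i => (Lp.coeFn_zero _ _ _).trans ?_,
      Lp.coeFn_zero _ _ _⟩
    refine Eventually.of_forall fun x => ?_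
    simp [classicalPartial]
  add_mem' := by
    rintro p q ⟨φ, hφ, h1, h2, h3⟩ ⟨ψ, hψ, k1, k2, k3⟩
    refine ⟨φ + ψ, hφ.add hψ, (Lp.coeFn_add _ _).trans (h1.add k1), fun i => ?_,
      (Lp.coeFn_add _ _).trans (h3.add k3)⟩
    refine (Lp.coeFn_add _ _).trans (((h2 i).add (k2 i)).trans ?_)
    exact Eventually.of_forall fun x => (classicalPartial_add i hφ hψ x).symm
  smul_mem' := by
    rintro c p ⟨φ, hφ, h1, h2, h3⟩
    refine ⟨c • φ, contDiff_const.smul hφ, (Lp.coeFn_smul _ _).trans (h1.const_smul c), fun i => ?_,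
      (Lp.coeFn_smul _ _).trans (h3.const_smul c)⟩
    refine (Lp.coeFn_smul _ _).trans (((h2 i).const_smul c).trans ?_)
    exact Eventually.of_forall fun x => (classicalPartial_const_smul i c hφ x).symm

/-- The graph of the trace operator: the pairs `(u, τ)` such that `u ∈ H¹(Ω)` has the trace `τ`. -/
noncomputable def traceGraph {d : ℕ} (Ω : Set (Euc d)) : Submodule ℂ (JetWithBoundary Ω) :=
  (SobolevH1 ℂ Ω).comap (WithLp.fstL 2 ℂ (LTwoJet ℂ Ω) (Lp ℂ 2 (surfaceMeasure Ω)) :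
    JetWithBoundary Ω →ₗ[ℂ] LTwoJet ℂ Ω) ⊓ (smoothJets Ω).topologicalClosure

/-- Both conditions defining the graph are closed. Completeness of the space of pairs is what
Lax-Milgram needs; the graph need not be that of a function. -/
instance {d : ℕ} {Ω : Set (Euc d)} : CompleteSpace (traceGraph Ω) :=
  (show IsClosed (traceGraph Ω : Set (JetWithBoundary Ω)) from
    ((isClosed_sobolevH1 ℂ Ω).preimage (WithLp.fstL 2 ℂ (LTwoJet ℂ Ω)
      (Lp ℂ 2 (surfaceMeasure Ω))).continuous).inter
      (smoothJets Ω).isClosed_topologicalClosure).completeSpace_coe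

theorem Continuous.memLp_of_ae_mem_isCompact {X F : Type*} [TopologicalSpace X]
    [MeasurableSpace X] [OpensMeasurableSpace X] [NormedAddCommGroup F]
    [SecondCountableTopologyEither X F] [TopologicalSpace.PseudoMetrizableSpace X] {μ : Measure X}
    [IsFiniteMeasure μ] {f : X → F} (hf : Continuous f) {K : Set X} (hK : IsCompact K)
    (hμ : ∀ᵐ x ∂μ, x ∈ K) (p : ENNReal) : MemLp f p μ := by
  obtain ⟨C, hC⟩ := hK.exists_bound_of_continuousOn hf.continuousOn
  exact MemLp.of_bound hf.aestronglyMeasurable C (hμ.mono hC)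

theorem IsSmoothBoundedDomain.memLp_restrict {d : ℕ} {Ω : Set (Euc d)}
    (hΩ : IsSmoothBoundedDomain Ω) {f : Euc d → ℂ} (hf : Continuous f) :
    MemLp f 2 (volume.restrict Ω) := by
  have : IsFiniteMeasure ((volume : Measure (Euc d)).restrict Ω) :=
    isFiniteMeasure_restrict.2 hΩ.isBounded.measure_lt_top.ne
  refine hf.memLp_of_ae_mem_isCompact (K := closure Ω)
    (Metric.isCompact_of_isClosed_isBounded isClosed_closure hΩ.isBounded.closure) ?_ 2
  exact (ae_restrict_mem hΩ.isOpen.measurableSet).mono fun x hx => subset_closure hx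

theorem IsSmoothBoundedDomain.memLp_surfaceMeasure {d : ℕ} {Ω : Set (Euc d)}
    (hΩ : IsSmoothBoundedDomain Ω) {f : Euc d → ℂ} (hf : Continuous f) :
    MemLp f 2 (surfaceMeasure Ω) := by
  have := hΩ.isFiniteMeasure_surfaceMeasure
  refine hf.memLp_of_ae_mem_isCompact (K := closure Ω)
    (Metric.isCompact_of_isClosed_isBounded isClosed_closure hΩ.isBounded.closure) ?_ 2
  exact (ae_restrict_mem isClosed_frontier.measurableSet).mono fun x hx => frontier_subset_closure hx

/-- The pairs in the graph of the trace operator are exactly those related by `IsTrace`. -/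
theorem IsSmoothBoundedDomain.mem_traceGraph_iff {d : ℕ} {Ω : Set (Euc d)}
    (hΩ : IsSmoothBoundedDomain Ω) (u : SobolevH1 ℂ Ω)
    (τ : Lp ℂ 2 (surfaceMeasure Ω)) :
    (WithLp.toLp 2 (u.1, τ) : JetWithBoundary Ω) ∈ traceGraph Ω ↔ IsTrace u τ := by
  have hmem : (WithLp.toLp 2 (u.1, τ) : JetWithBoundary Ω) ∈ traceGraph Ω ↔
      (WithLp.toLp 2 (u.1, τ) : JetWithBoundary Ω) ∈
        closure (smoothJets Ω : Set (JetWithBoundary Ω)) := ⟨fun h => h.2, fun h => ⟨u.2, h⟩⟩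
  rw [hmem, mem_closure_iff_seq_limit]
  constructor
  · rintro ⟨q, hq, hlim⟩
    choose φ hφ h1 h2 h3 using hq
    have l1 : Tendsto (fun n => (q n).fst.fst) atTop (𝓝 u.1.fst) :=
      ((WithLp.fstL 2 ℂ _ _ ∘L WithLp.fstL 2 ℂ _ _ : JetWithBoundary Ω →L[ℂ] _).continuous.tendsto
        _).comp hlim
    have l2 : ∀ i, Tendsto (fun n => (q n).fst.snd i) atTop (𝓝 (u.1.snd i)) := fun i =>
      ((PiLp.proj (𝕜 := ℂ) 2 (fun _ : Fin d => LTwo ℂ Ω) i ∘L WithLp.sndL 2 ℂ _ _ ∘L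
        WithLp.fstL 2 ℂ _ _ : JetWithBoundary Ω →L[ℂ] _).continuous.tendsto _).comp hlim
    have l3 : Tendsto (fun n => (q n).snd) atTop (𝓝 τ) :=
      ((WithLp.sndL 2 ℂ _ _ : JetWithBoundary Ω →L[ℂ] _).continuous.tendsto _).comp hlim
    rw [Lp.tendsto_Lp_iff_tendsto_eLpNorm'] at l1 l3
    refine ⟨φ, hφ, l1.congr fun n => ?_, fun i => ?_, l3.congr fun n => ?_⟩
    · exact eLpNorm_congr_ae ((h1 n).sub (ae_eq_refl _))
    · have l2i := l2 i
      rw [Lp.tendsto_Lp_iff_tendsto_eLpNorm'] at l2i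
      exact l2i.congr fun n => eLpNorm_congr_ae ((h2 n i).sub (ae_eq_refl _))
    · exact eLpNorm_congr_ae ((h3 n).sub (ae_eq_refl _))
  · rintro ⟨φ, hφ, h1, h2, h3⟩
    -- Boundedness of `Ω` and finiteness of the surface measure turn the approximating functions
    -- into elements of the `L²` spaces, where the `eLpNorm` limits become norm convergence.
    have m1 := fun n => hΩ.memLp_restrict (hφ n).continuous
    have m2 := fun n i => hΩ.memLp_restrict (continuous_classicalPartial_complex i (hφ n))
    have m3 := fun n => hΩ.memLp_surfaceMeasure (hφ n).continuous
    refine ⟨fun n => WithLp.toLp 2 (WithLp.toLp 2 ((m1 n).toLp,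
      WithLp.toLp 2 fun i => (m2 n i).toLp), (m3 n).toLp), fun n => ⟨φ n, hφ n, (m1 n).coeFn_toLp,
      fun i => (m2 n i).coeFn_toLp, (m3 n).coeFn_toLp⟩, ?_⟩
    have l1 : Tendsto (fun n => (m1 n).toLp) atTop (𝓝 u.1.fst) := by
      rw [Lp.tendsto_Lp_iff_tendsto_eLpNorm']
      exact h1.congr fun n => eLpNorm_congr_ae ((m1 n).coeFn_toLp.symm.sub (ae_eq_refl _))
    have l2 : ∀ i, Tendsto (fun n => (m2 n i).toLp) atTop (𝓝 (u.1.snd i)) := fun i => by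
      rw [Lp.tendsto_Lp_iff_tendsto_eLpNorm']
      exact (h2 i).congr fun n => eLpNorm_congr_ae ((m2 n i).coeFn_toLp.symm.sub (ae_eq_refl _))
    have l3 : Tendsto (fun n => (m3 n).toLp) atTop (𝓝 τ) := by
      rw [Lp.tendsto_Lp_iff_tendsto_eLpNorm']
      exact h3.congr fun n => eLpNorm_congr_ae ((m3 n).coeFn_toLp.symm.sub (ae_eq_refl _))
    have l2' : Tendsto (fun n => (WithLp.toLp 2 fun i => (m2 n i).toLp :
        PiLp 2 fun _ : Fin d => LTwo ℂ Ω)) atTop (𝓝 u.1.snd) :=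
      ((PiLp.continuous_toLp 2 _).tendsto (WithLp.ofLp u.1.snd)).comp (tendsto_pi_nhds.2 l2)
    have l12 := ((WithLp.prod_continuous_toLp 2 _ _).tendsto
      (u.1.fst, u.1.snd)).comp (l1.prodMk_nhds l2')
    exact ((WithLp.prod_continuous_toLp 2 _ _).tendsto
      (u.1, τ)).comp (l12.prodMk_nhds l3)

/-! ### Lax-Milgram for the complex Robin form -/

section RobinProblem

open scoped InnerProductSpace InnerProduct

/-- A continuous sesquilinear form `⟪S x, S y⟫ + i ⟪T x, T y⟫` with `‖x‖² = ‖S x‖² + ‖T x‖²` is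
represented by an invertible operator. -/
theorem isUnit_adjoint_mul_self_add_I_smul {V H G : Type*} [NormedAddCommGroup V]
    [InnerProductSpace ℂ V] [CompleteSpace V] [NormedAddCommGroup H] [InnerProductSpace ℂ H]
    [CompleteSpace H] [NormedAddCommGroup G] [InnerProductSpace ℂ G] [CompleteSpace G]
    (S : V →L[ℂ] H) (T : V →L[ℂ] G) (hST : ∀ x, ‖x‖ ^ 2 = ‖S x‖ ^ 2 + ‖T x‖ ^ 2) :
    IsUnit (S† ∘L S + Complex.I • (T† ∘L T)) := by
  -- With `a = ‖S x‖²` and `b = ‖T x‖²`, `|a - i b| ≥ max a b ≥ (a + b) / 2`, whence the constant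
  -- `1/2`.
  refine ContinuousLinearMap.isUnit_of_forall_le_norm_inner_map _ (c := 1 / 2) (by norm_num)
    fun x => ?_
  have e : ⟪(S† ∘L S + Complex.I • (T† ∘L T)) x, x⟫_ℂ
      = ((‖S x‖ ^ 2 : ℝ) : ℂ) - Complex.I * ((‖T x‖ ^ 2 : ℝ) : ℂ) := by
    simp only [add_apply, smul_apply,
      ContinuousLinearMap.comp_apply, inner_add_left, inner_smul_left,
      ContinuousLinearMap.adjoint_inner_left, inner_self_eq_norm_sq_to_K, Complex.conj_I]
    push_cast
    simp only [Complex.coe_algebraMap]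
    ring
  rw [e, hST x]
  set a := ‖S x‖ ^ 2
  set b := ‖T x‖ ^ 2
  have ha : 0 ≤ a := sq_nonneg _
  have hb : 0 ≤ b := sq_nonneg _
  have h1 := Complex.abs_re_le_norm ((a : ℂ) - Complex.I * (b : ℂ))
  have h2 := Complex.abs_im_le_norm ((a : ℂ) - Complex.I * (b : ℂ))
  simp at h1 h2
  rw [abs_of_nonneg ha] at h1
  rw [abs_of_nonneg hb] at h2
  simp only [NNReal.coe_div, NNReal.coe_one, NNReal.coe_ofNat]
  linarith

/-- The Lax-Milgram theorem for the form `⟪S x, S y⟫ + i ⟪T x, T y⟫` with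
`‖x‖² = ‖S x‖² + ‖T x‖²`: the solution depends linearly and continuously on the data. -/
theorem exists_solutionOperators_of_norm_sq_eq {V H G X : Type*} [NormedAddCommGroup V]
    [InnerProductSpace ℂ V] [CompleteSpace V] [NormedAddCommGroup H] [InnerProductSpace ℂ H]
    [CompleteSpace H] [NormedAddCommGroup G] [InnerProductSpace ℂ G] [CompleteSpace G]
    [NormedAddCommGroup X] [InnerProductSpace ℂ X] [CompleteSpace X]
    (S : V →L[ℂ] H) (T : V →L[ℂ] G) (R : V →L[ℂ] X)
    (hST : ∀ x, ‖x‖ ^ 2 = ‖S x‖ ^ 2 + ‖T x‖ ^ 2) :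
    ∃ (L : X →L[ℂ] V) (B : G →L[ℂ] V), ∀ F g x,
      (∀ y, ⟪S y, S x⟫_ℂ + Complex.I * ⟪T y, T x⟫_ℂ = ⟪R y, F⟫_ℂ + ⟪T y, g⟫_ℂ) ↔
        x = L F + B g := by
  obtain ⟨A', hA'⟩ := isUnit_adjoint_mul_self_add_I_smul S T hST
  set A : V →L[ℂ] V := S† ∘L S + Complex.I • (T† ∘L T) with hA
  let A'' : V →L[ℂ] V := (A'⁻¹ : Units _)
  have hinv : ∀ x, A (A'' x) = x := fun x => by
    have : (A * A'') x = x := by rw [← hA', Units.mul_inv]; rfl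
    exact this
  have hinv' : ∀ x, A'' (A x) = x := fun x => by
    have : (A'' * A) x = x := by rw [← hA', Units.inv_mul]; rfl
    exact this
  -- Testing with every `y` says `A x = R† F + T† g`; inverting `A` gives both operators.
  refine ⟨A'' ∘L R†, A'' ∘L T†, fun F g x => ?_⟩
  have hform : ∀ y, ⟪S y, S x⟫_ℂ + Complex.I * ⟪T y, T x⟫_ℂ = ⟪y, A x⟫_ℂ := fun y => by
    simp only [hA, add_apply, smul_apply, ContinuousLinearMap.comp_apply, inner_add_right,
      inner_smul_right, ContinuousLinearMap.adjoint_inner_right]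
  have hrhs : ∀ y, ⟪R y, F⟫_ℂ + ⟪T y, g⟫_ℂ = ⟪y, (R†) F + (T†) g⟫_ℂ := fun y => by
    simp only [inner_add_right, ContinuousLinearMap.adjoint_inner_right]
  simp only [hform, hrhs, ContinuousLinearMap.comp_apply, ← map_add]
  refine ⟨fun h => ?_, fun h y => by rw [h, hinv]⟩
  rw [← ext_inner_left ℂ h, hinv']

/-- The Lax-Milgram theorem for the form `⟪u, ψ⟫ + i ⟪τ, σ⟫` on a complete space of pairs. -/
theorem exists_solutionOperators_of_submodule_prod {H G X : Type*} [NormedAddCommGroup H]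
    [InnerProductSpace ℂ H] [CompleteSpace H] [NormedAddCommGroup G] [InnerProductSpace ℂ G]
    [CompleteSpace G] [NormedAddCommGroup X] [InnerProductSpace ℂ X] [CompleteSpace X]
    (V : Submodule ℂ (WithLp 2 (H × G))) [CompleteSpace V] (R : H →L[ℂ] X) :
    ∃ (L : X →L[ℂ] V) (B : G →L[ℂ] V), ∀ F g x,
      (∀ y : V, ⟪y.1.fst, x.1.fst⟫_ℂ + Complex.I * ⟪y.1.snd, x.1.snd⟫_ℂ
        = ⟪R y.1.fst, F⟫_ℂ + ⟪y.1.snd, g⟫_ℂ) ↔ x = L F + B g :=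
  exists_solutionOperators_of_norm_sq_eq (WithLp.fstL 2 ℂ H G ∘L V.subtypeL)
    (WithLp.sndL 2 ℂ H G ∘L V.subtypeL) (R ∘L WithLp.fstL 2 ℂ H G ∘L V.subtypeL)
    fun x => WithLp.prod_norm_sq_eq_of_L2 x.1

theorem lTwo_inner_eq_integral {α : Type*} [MeasurableSpace α] {μ : Measure α}
    (f g : Lp ℂ 2 μ) : ⟪f, g⟫_ℂ = ∫ x, g x * (starRingEnd ℂ) (f x) ∂μ := by
  rw [L2.inner_def]
  rfl

theorem integrable_lTwo_mul_conj {α : Type*} [MeasurableSpace α] {μ : Measure α}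
    (f g : Lp ℂ 2 μ) : Integrable (fun x => g x * (starRingEnd ℂ) (f x)) μ :=
  L2.integrable_inner (𝕜 := ℂ) f g

/-- The form of the Robin problem in terms of inner products. -/
theorem ccbmForm_eq_inner {d : ℕ} {Ω : Set (Euc d)} (u ψ : SobolevH1 ℂ Ω)
    (τu τψ : Lp ℂ 2 (surfaceMeasure Ω)) :
    ccbmForm u ψ τu τψ = ⟪ψ.1, u.1⟫_ℂ + Complex.I * ⟪τψ, τu⟫_ℂ := by
  have h : ⟪ψ.1, u.1⟫_ℂ = ⟪ψ.1.fst, u.1.fst⟫_ℂ + ∑ i, ⟪ψ.1.snd i, u.1.snd i⟫_ℂ := by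
    rw [WithLp.prod_inner_apply, PiLp.inner_apply]
    rfl
  rw [h]
  simp only [lTwo_inner_eq_integral]
  rw [ccbmForm, integral_add, integral_finsetSum, add_comm (∑ i, _)]
  · rfl
  · exact fun i _ => integrable_lTwo_mul_conj (ψ.1.snd i) (u.1.snd i)
  · exact integrable_finsetSum _ fun i _ => integrable_lTwo_mul_conj (ψ.1.snd i) (u.1.snd i)
  · exact integrable_lTwo_mul_conj ψ.1.fst u.1.fst

/-- The weak Robin problem is uniquely solvable, and the solution is given by bounded linear
operators applied to the data. -/
theorem IsSmoothBoundedDomain.exists_robinSolver {d : ℕ} {Ω : Set (Euc d)}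
    (hΩ : IsSmoothBoundedDomain Ω) :
    ∃ (S : LTwo ℂ Ω →L[ℂ] SobolevH1 ℂ Ω) (B : Lp ℂ 2 (surfaceMeasure Ω) →L[ℂ] SobolevH1 ℂ Ω),
      ∀ (f g : Euc d → ℂ) (F : LTwo ℂ Ω) (G : Lp ℂ 2 (surfaceMeasure Ω)),
        f =ᵐ[volume.restrict Ω] F → g =ᵐ[surfaceMeasure Ω] G →
        ∀ u, IsWeakRobinSolution Ω f g u ↔ u = S F + B G := by
  obtain ⟨L, B, hLB⟩ := exists_solutionOperators_of_submodule_prod (traceGraph Ω)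
    (WithLp.fstL 2 ℂ _ _ : LTwoJet ℂ Ω →L[ℂ] LTwo ℂ Ω)
  let π : traceGraph Ω →L[ℂ] SobolevH1 ℂ Ω :=
    ((WithLp.fstL 2 ℂ _ _ : JetWithBoundary Ω →L[ℂ] LTwoJet ℂ Ω) ∘L
      (traceGraph Ω).subtypeL).codRestrict (SobolevH1 ℂ Ω) fun x => x.2.1
  refine ⟨π ∘L L, π ∘L B, fun f g F G hf hg u => ?_⟩
  have hform : ∀ x y : traceGraph Ω, ccbmForm (π x) (π y) x.1.snd y.1.snd
      = ⟪y.1.fst, x.1.fst⟫_ℂ + Complex.I * ⟪y.1.snd, x.1.snd⟫_ℂ :=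
    fun x y => ccbmForm_eq_inner _ _ _ _
  have hrhs : ∀ y : traceGraph Ω, ((∫ x in Ω, f x * (starRingEnd ℂ) (h1Val (π y) x))
      + ∫ x, g x * (starRingEnd ℂ) (y.1.snd x) ∂(surfaceMeasure Ω))
      = ⟪y.1.fst.fst, F⟫_ℂ + ⟪y.1.snd, G⟫_ℂ := by
    intro y
    rw [lTwo_inner_eq_integral, lTwo_inner_eq_integral]
    congr 1
    · refine integral_congr_ae ?_
      filter_upwards [hf] with x hx
      rw [hx]
      rfl
    · refine integral_congr_ae ?_
      filter_upwards [hg] with x hx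
      rw [hx]
  have hsol : (π ∘L L) F + (π ∘L B) G = π (L F + B G) := by
    simp only [ContinuousLinearMap.comp_apply, map_add]
  rw [hsol]
  constructor
  · rintro ⟨τ, hτ, h⟩
    -- A weak solution together with any of its traces is a point of the graph, and the admissible
    -- test pairs are exactly the points of the graph.
    let x : traceGraph Ω := ⟨WithLp.toLp 2 (u.1, τ), (hΩ.mem_traceGraph_iff _ _).2 hτ⟩
    have hx : x = L F + B G := (hLB F G x).1 fun y => by
      refine (hform x y).symm.trans (Eq.trans ?_ (hrhs y))
      exact h (π y) y.1.snd ((hΩ.mem_traceGraph_iff (π y) y.1.snd).1 y.2)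
    rw [← hx]
    rfl
  · intro hu
    set x := L F + B G with hx
    refine ⟨x.1.snd, ?_, fun ψ τ hτ => ?_⟩
    · rw [hu]
      exact (hΩ.mem_traceGraph_iff (π x) x.1.snd).1 x.2
    · let y : traceGraph Ω := ⟨WithLp.toLp 2 (ψ.1, τ), (hΩ.mem_traceGraph_iff _ _).2 hτ⟩
      rw [hu]
      exact (hform x y).trans (((hLB F G x).2 hx y).trans (hrhs y).symm)

end RobinProblem

/-! ### The damped linear evolution equation -/

/-- This bound for the first-order field of `(p, v)` serves as the Lipschitz constant for existence
and as the rate in Gronwall's inequality. -/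
theorem norm_damped_field_le {P : Type*} [NormedAddCommGroup P] [NormedSpace ℝ P] (K : P →L[ℝ] P)
    (c : ℝ) (z : P × P) : ‖(z.2, -(c • z.2) - K z.1)‖ ≤ (1 + |c| + ‖K‖) * ‖z‖ := by
  have h1 : ‖z.1‖ ≤ ‖z‖ := norm_fst_le z
  have h2 : ‖z.2‖ ≤ ‖z‖ := norm_snd_le z
  have h3 : ‖K z.1‖ ≤ ‖K‖ * ‖z‖ := (K.le_opNorm _).trans (by gcongr)
  have h4 : ‖-(c • z.2)‖ ≤ |c| * ‖z‖ := by
    rw [norm_neg, norm_smul, Real.norm_eq_abs]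
    gcongr
  have h5 : 0 ≤ (|c| + ‖K‖) * ‖z‖ := by positivity
  have h6 := norm_sub_le (-(c • z.2)) (K z.1)
  refine max_le ?_ ?_
  · linarith
  · linarith [norm_nonneg z]

/-- `(p, v)` solves `p' = v` on `[0,∞)`, `v' = -η(t) v - (K p + k)` on `(0,∞)`,
`p(0) = p₀`, `v(0) = v₀`. -/
structure IsDampedSolution {P : Type*} [NormedAddCommGroup P] [NormedSpace ℝ P] (η : ℝ → ℝ)
    (K : P →L[ℝ] P) (k p₀ v₀ : P) (p v : ℝ → P) : Prop where
  hasDeriv : ∀ t ∈ Ici (0 : ℝ), HasDerivWithinAt p (v t) (Ici 0) t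
  continuous_velocity : ContinuousOn v (Ici 0)
  initial_position : p 0 = p₀
  initial_velocity : v 0 = v₀
  evolution : ∀ t ∈ Ioi (0 : ℝ), HasDerivAt v (-(η t • v t) - (K (p t) + k)) t

namespace IsDampedSolution

variable {P : Type*} [NormedAddCommGroup P] [NormedSpace ℝ P] {η : ℝ → ℝ} {K : P →L[ℝ] P}

theorem exists_of_continuousOn [CompleteSpace P] (hη : ContinuousOn η (Ici 0)) (K : P →L[ℝ] P)
    (k p₀ v₀ : P) : ∃ p v : ℝ → P, IsDampedSolution η K k p₀ v₀ p v := by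
  -- The ODE theorem needs a field continuous for all real times, so `η` is continued by `η 0`.
  let e : ℝ → ℝ := fun t => η (max t 0)
  have he : Continuous e := hη.comp_continuous (continuous_id.max continuous_const)
    fun t => mem_Ici.2 (le_max_right _ _)
  let F : ℝ → P × P → P × P := fun t z => (z.2, -(e t • z.2) - (K z.1 + k))
  have hF : Continuous (Function.uncurry F) := by
    have h1 : Continuous fun q : ℝ × P × P => K q.2.1 :=
      K.continuous.comp (continuous_fst.comp continuous_snd)
    have h2 : Continuous fun q : ℝ × P × P => e q.1 := he.comp continuous_fst
    exact (continuous_snd.comp continuous_snd).prodMk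
      ((h2.smul (continuous_snd.comp continuous_snd)).neg.sub (h1.add continuous_const))
  have hLip : ∀ t x y, ‖F t x - F t y‖ ≤ (1 + |e t| + ‖K‖) * ‖x - y‖ := by
    intro t x y
    have hs : F t x - F t y = ((x - y).2, -(e t • (x - y).2) - K (x - y).1) := by
      ext
      · rfl
      · simp only [F, Prod.snd_sub, Prod.fst_sub, smul_sub, map_sub]
        abel
    rw [hs]
    exact norm_damped_field_le _ _ _
  obtain ⟨x, hx0, hx⟩ := exists_global_hasDerivAt_of_lipschitz hF
    (m := fun t => 1 + |e t| + ‖K‖) (by fun_prop) hLip (p₀, v₀)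
  have hp : ∀ t, 0 ≤ t → HasDerivAt (fun t => (x t).1) (x t).2 t := fun t ht => (hx t ht).fst
  have hv : ∀ t, 0 ≤ t → HasDerivAt (fun t => (x t).2)
    (-(e t • (x t).2) - (K (x t).1 + k)) t := fun t ht => (hx t ht).snd
  refine ⟨fun t => (x t).1, fun t => (x t).2, fun t ht => (hp t ht).hasDerivWithinAt,
    fun t ht => (hv t ht).continuousAt.continuousWithinAt, by simp [hx0], by simp [hx0],
    fun t ht => ?_⟩
  have het : e t = η t := by simp only [e, max_eq_left (mem_Ioi.1 ht).le]
  have := hv t (mem_Ioi.1 ht).le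
  rwa [het] at this

theorem continuousOn_position {k p₀ v₀ : P} {p v : ℝ → P}
    (h : IsDampedSolution η K k p₀ v₀ p v) : ContinuousOn p (Ici 0) :=
  fun t ht => (h.hasDeriv t ht).continuousWithinAt

/-- The equation is assumed for `t > 0` only, whereas Gronwall needs a right derivative at `0` too.
It exists because `v` is continuous at `0` and `v'` has a limit there, the right-hand side being
continuous up to `0`. -/
theorem hasDerivWithinAt_velocity (hη : ContinuousOn η (Ici 0)) {k p₀ v₀ : P} {p v : ℝ → P}
    (h : IsDampedSolution η K k p₀ v₀ p v) {t : ℝ} (ht : 0 ≤ t) :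
    HasDerivWithinAt v (-(η t • v t) - (K (p t) + k)) (Ici t) t := by
  rcases ht.eq_or_lt with rfl | ht
  · have hc : ContinuousOn (fun t => -(η t • v t) - (K (p t) + k)) (Ici 0) :=
      (hη.smul h.continuous_velocity).neg.sub
        ((K.continuous.comp_continuousOn h.continuousOn_position).add continuousOn_const)
    refine hasDerivWithinAt_Ici_of_tendsto_deriv (s := Ioi 0)
      (fun s hs => (h.evolution s hs).differentiableAt.differentiableWithinAt)
      ((h.continuous_velocity 0 self_mem_Ici).mono Ioi_subset_Ici_self) self_mem_nhdsWithin ?_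
    refine Tendsto.congr' ?_ ((hc 0 self_mem_Ici).mono Ioi_subset_Ici_self)
    exact eventually_mem_nhdsWithin.mono fun s hs => (h.evolution s hs).deriv.symm
  · exact (h.evolution t ht).hasDerivWithinAt

/-- Solutions with the same initial values depend Lipschitz continuously on the constant force,
uniformly on bounded time intervals. -/
theorem exists_norm_sub_le (hη : ContinuousOn η (Ici 0)) (K : P →L[ℝ] P) (T : ℝ) :
    ∃ C : ℝ, 0 ≤ C ∧ ∀ (k k' p₀ v₀ : P) (p v p' v' : ℝ → P),
      IsDampedSolution η K k p₀ v₀ p v → IsDampedSolution η K k' p₀ v₀ p' v' →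
      ∀ t ∈ Icc (0 : ℝ) T, ‖p' t - p t‖ ≤ C * ‖k' - k‖ ∧ ‖v' t - v t‖ ≤ C * ‖k' - k‖ := by
  obtain ⟨E, hE⟩ := (isCompact_Icc (a := (0 : ℝ)) (b := T)).exists_bound_of_continuousOn
    (hη.mono Icc_subset_Ici_self)
  let M : ℝ := 1 + |E| + ‖K‖
  have hM : 0 < M := by positivity
  -- Gronwall with zero initial difference and forcing `‖k' - k‖` gives `‖k' - k‖ (e^(Mt) - 1) / M`.
  refine ⟨Real.exp (M * T) / M, by positivity, fun k k' p₀ v₀ p v p' v' h h' => ?_⟩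
  let z : ℝ → P × P := fun t => (p' t - p t, v' t - v t)
  have hz : ContinuousOn z (Icc 0 T) :=
    ((h'.continuousOn_position.sub h.continuousOn_position).prodMk
      (h'.continuous_velocity.sub h.continuous_velocity)).mono Icc_subset_Ici_self
  have hz' : ∀ t ∈ Ico 0 T, HasDerivWithinAt z (v' t - v t,
      (-(η t • v' t) - (K (p' t) + k')) - (-(η t • v t) - (K (p t) + k))) (Ici t) t := fun t ht =>
    (((h'.hasDeriv t ht.1).sub (h.hasDeriv t ht.1)).mono (Ici_subset_Ici.2 ht.1)).prodMk
      ((h'.hasDerivWithinAt_velocity hη ht.1).sub (h.hasDerivWithinAt_velocity hη ht.1))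
  have hz0 : ‖z 0‖ ≤ 0 := by
    simp [z, h.initial_position, h'.initial_position, h.initial_velocity, h'.initial_velocity]
  intro t ht
  have key := norm_le_gronwallBound_of_norm_deriv_right_le hz hz' hz0 (K := M) (ε := ‖k' - k‖)
    (fun s hs => ?_) t ht
  · simp only [gronwallBound_of_K_ne_0 hM.ne', zero_mul, zero_add, sub_zero] at key
    have h1 : ‖k' - k‖ / M * (Real.exp (M * t) - 1) ≤ Real.exp (M * T) / M * ‖k' - k‖ := by
      have h2 : Real.exp (M * t) ≤ Real.exp (M * T) := by
        have := ht.2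
        gcongr
      calc ‖k' - k‖ / M * (Real.exp (M * t) - 1) ≤ ‖k' - k‖ / M * Real.exp (M * T) := by
            gcongr
            linarith
        _ = _ := by ring
    exact ⟨(norm_fst_le (z t)).trans (key.trans h1), (norm_snd_le (z t)).trans (key.trans h1)⟩
  · have e : (-(η s • v' s) - (K (p' s) + k')) - (-(η s • v s) - (K (p s) + k))
        = (-(η s • (z s).2) - K (z s).1) - (k' - k) := by
      simp only [z, smul_sub, map_sub]
      abel
    rw [e]
    have hEs : |η s| ≤ |E| := (hE s (Ico_subset_Icc_self hs)).trans (le_abs_self E)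
    have h1 : ‖((z s).2, -(η s • (z s).2) - K (z s).1)‖ ≤ M * ‖z s‖ :=
      (norm_damped_field_le _ _ _).trans (by change _ ≤ (1 + |E| + ‖K‖) * ‖z s‖; gcongr)
    have e' : ((z s).2, -(η s • (z s).2) - K (z s).1 - (k' - k))
        = ((z s).2, -(η s • (z s).2) - K (z s).1) - (0, k' - k) := by simp
    change ‖((z s).2, -(η s • (z s).2) - K (z s).1 - (k' - k))‖ ≤ _
    rw [e']
    refine (norm_sub_le _ _).trans (add_le_add h1 ?_)
    simp [Prod.norm_def]

end IsDampedSolution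

/-! ### The reduced coupled system -/

/-- The reduced form of the coupled system: `u` and `w` are affine functions of `p`, and `p` solves
a damped linear evolution equation. -/
structure IsReducedSolution {P H : Type*} [NormedAddCommGroup P] [NormedSpace ℝ P]
    [NormedAddCommGroup H] [NormedSpace ℝ H] (η : ℝ → ℝ) (S : P →L[ℝ] H) (W : H →L[ℝ] H)
    (R : H →L[ℝ] P) (b : H) (p₀ v₀ : P) (p v : ℝ → P) (u w : ℝ → H) : Prop where
  damped : IsDampedSolution η (R ∘L W ∘L S) (R (W b)) p₀ v₀ p v
  state : ∀ t ∈ Ioi (0 : ℝ), u t = S (p t) + b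
  adjoint : ∀ t ∈ Ioi (0 : ℝ), w t = W (u t)

namespace IsReducedSolution

variable {P H : Type*} [NormedAddCommGroup P] [NormedSpace ℝ P] [NormedAddCommGroup H]
  [NormedSpace ℝ H] {η : ℝ → ℝ}

theorem exists_of_continuousOn [CompleteSpace P] (hη : ContinuousOn η (Ici 0)) (S : P →L[ℝ] H)
    (W : H →L[ℝ] H) (R : H →L[ℝ] P) (b : H) (p₀ v₀ : P) :
    ∃ p v u w, IsReducedSolution η S W R b p₀ v₀ p v u w := by
  obtain ⟨p, v, h⟩ := IsDampedSolution.exists_of_continuousOn hη (R ∘L W ∘L S) (R (W b)) p₀ v₀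
  exact ⟨p, v, fun t => S (p t) + b, fun t => W (S (p t) + b), h, fun _ _ => rfl, fun _ _ => rfl⟩

/-- Lipschitz continuous dependence on the inhomogeneity, uniformly on bounded time intervals. -/
theorem exists_norm_sub_le (hη : ContinuousOn η (Ici 0)) (S : P →L[ℝ] H) (W : H →L[ℝ] H)
    (R : H →L[ℝ] P) (T : ℝ) :
    ∃ c : ℝ, 0 ≤ c ∧ ∀ (b b' : H) (p₀ v₀ : P) (p v p' v' : ℝ → P) (u w u' w' : ℝ → H),
      IsReducedSolution η S W R b p₀ v₀ p v u w →
      IsReducedSolution η S W R b' p₀ v₀ p' v' u' w' →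
      (∀ t ∈ Icc (0 : ℝ) T, ‖p' t - p t‖ ≤ c * ‖b' - b‖ ∧ ‖v' t - v t‖ ≤ c * ‖b' - b‖) ∧
      (∀ t ∈ Ioc (0 : ℝ) T, ‖u' t - u t‖ ≤ c * ‖b' - b‖ ∧ ‖w' t - w t‖ ≤ c * ‖b' - b‖) := by
  obtain ⟨C, hC0, hC⟩ := IsDampedSolution.exists_norm_sub_le hη (R ∘L W ∘L S) T
  -- `c₁` bounds `p` and `v`, `c₂` bounds `u`, and `‖W‖ * c₂` bounds `w`; their sum serves for all
  -- four.
  let c₁ : ℝ := C * (‖R‖ * ‖W‖)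
  let c₂ : ℝ := ‖S‖ * c₁ + 1
  have hc₁ : 0 ≤ c₁ := by positivity
  have hc₂ : 0 ≤ c₂ := by positivity
  have hc₃ : 0 ≤ ‖W‖ * c₂ := by positivity
  refine ⟨c₁ + c₂ + ‖W‖ * c₂, by positivity, fun b b' p₀ v₀ p v p' v' u w u' w' h h' => ?_⟩
  set β := ‖b' - b‖
  have hβ : 0 ≤ β := norm_nonneg _
  have hk : ‖R (W b') - R (W b)‖ ≤ ‖R‖ * (‖W‖ * β) := by
    rw [← map_sub, ← map_sub]
    exact R.le_opNorm_of_le (W.le_opNorm _)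
  have hpv : ∀ t ∈ Icc 0 T, ‖p' t - p t‖ ≤ c₁ * β ∧ ‖v' t - v t‖ ≤ c₁ * β := fun t ht => by
    have h1 := hC _ _ _ _ _ _ _ _ h.damped h'.damped t ht
    have h2 : C * ‖R (W b') - R (W b)‖ ≤ c₁ * β :=
      (mul_le_mul_of_nonneg_left hk hC0).trans (le_of_eq (by simp only [c₁]; ring))
    exact ⟨h1.1.trans h2, h1.2.trans h2⟩
  have hmono : ∀ r, r ≤ c₁ + c₂ + ‖W‖ * c₂ → r * β ≤ (c₁ + c₂ + ‖W‖ * c₂) * β := fun r hr => by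
    gcongr
  refine ⟨fun t ht => ?_, fun t ht => ?_⟩
  · have h1 := hmono c₁ (by linarith)
    exact ⟨(hpv t ht).1.trans h1, (hpv t ht).2.trans h1⟩
  · have hu : ‖u' t - u t‖ ≤ c₂ * β := by
      rw [h'.state t ht.1, h.state t ht.1, add_sub_add_comm, ← map_sub]
      refine (norm_add_le _ _).trans ((add_le_add_left
        (S.le_opNorm_of_le (hpv t ⟨ht.1.le, ht.2⟩).1) _).trans (le_of_eq ?_))
      simp only [c₂, β]
      ring
    have hw : ‖w' t - w t‖ ≤ ‖W‖ * c₂ * β := by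
      rw [h'.adjoint t ht.1, h.adjoint t ht.1, ← map_sub, mul_assoc]
      exact W.le_opNorm_of_le hu
    exact ⟨hu.trans (hmono _ (by linarith)), hw.trans (hmono _ (by linarith))⟩

/-- The dependence estimate with equal inhomogeneities has right-hand side zero. -/
theorem unique (hη : ContinuousOn η (Ici 0)) {S : P →L[ℝ] H} {W : H →L[ℝ] H} {R : H →L[ℝ] P}
    {b : H} {p₀ v₀ : P} {p v p' v' : ℝ → P} {u w u' w' : ℝ → H}
    (h : IsReducedSolution η S W R b p₀ v₀ p v u w)
    (h' : IsReducedSolution η S W R b p₀ v₀ p' v' u' w') :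
    (∀ t ∈ Ici (0 : ℝ), p' t = p t ∧ v' t = v t) ∧
      (∀ t ∈ Ioi (0 : ℝ), u' t = u t ∧ w' t = w t) := by
  have heq : ∀ t ∈ Ici (0 : ℝ), p' t = p t ∧ v' t = v t := fun t ht => by
    obtain ⟨C, -, hC⟩ := IsDampedSolution.exists_norm_sub_le hη (R ∘L W ∘L S) t
    have := hC _ _ _ _ _ _ _ _ h.damped h'.damped t ⟨ht, le_rfl⟩
    rwa [sub_self, norm_zero, mul_zero, norm_le_zero_iff, norm_le_zero_iff, sub_eq_zero,
      sub_eq_zero] at this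
  refine ⟨heq, fun t ht => ?_⟩
  rw [h'.adjoint t ht, h.adjoint t ht, h'.state t ht, h.state t ht, (heq t (mem_Ioi.1 ht).le).1]
  exact ⟨rfl, rfl⟩

end IsReducedSolution

/-! ### Reduction of the coupled system -/

/-- The imaginary part on `L²(Ω)`, as a complex-valued function. -/
noncomputable def lTwoIm {d : ℕ} (Ω : Set (Euc d)) : LTwo ℂ Ω →L[ℝ] LTwo ℂ Ω :=
  (Complex.ofRealCLM ∘L Complex.imCLM).compLpL 2 (volume.restrict Ω)

/-- The function underlying an element of `H¹(G)`, as an element of `L²(G)`. -/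
noncomputable def h1ToLTwo {d : ℕ} (𝕜 : Type*) [RCLike 𝕜] (G : Set (Euc d)) :
    SobolevH1 𝕜 G →L[𝕜] LTwo 𝕜 G :=
  WithLp.fstL 2 𝕜 _ _ ∘L (SobolevH1 𝕜 G).subtypeL

/-- The two boundary value problems are uniquely solvable, with solutions depending affinely and
continuously on the source, the boundary data and the state. -/
theorem IsSmoothBoundedDomain.exists_state_adjoint_operators {d : ℕ} {Ω : Set (Euc d)}
    (hΩ : IsSmoothBoundedDomain Ω) :
    ∃ (S : LTwo ℂ Ω →L[ℝ] SobolevH1 ℂ Ω) (B₁ B₂ : Lp ℝ 2 (surfaceMeasure Ω) →L[ℝ] SobolevH1 ℂ Ω)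
      (W : SobolevH1 ℂ Ω →L[ℝ] SobolevH1 ℂ Ω),
      (∀ (f : Euc d → ℂ) (F : LTwo ℂ Ω), f =ᵐ[volume.restrict Ω] F → ∀ (g₁ g₂ : Euc d → ℝ)
        (h₁ : MemLp g₁ 2 (surfaceMeasure Ω)) (h₂ : MemLp g₂ 2 (surfaceMeasure Ω)) (u),
        IsWeakRobinSolution Ω f (fun x => (g₂ x : ℂ) + Complex.I * (g₁ x : ℂ)) u ↔
          u = S F + (B₁ h₁.toLp + B₂ h₂.toLp)) ∧
      ∀ u w, IsWeakRobinSolution Ω (fun x => (((h1Val u x).im : ℝ) : ℂ)) (fun _ => 0) w ↔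
        w = W u := by
  obtain ⟨S, B, hSB⟩ := hΩ.exists_robinSolver
  -- Taking imaginary parts is only real-linear, so the complex solution operators are used over `ℝ`
  -- from here on.
  let S' : LTwo ℂ Ω →L[ℝ] SobolevH1 ℂ Ω := S.restrictScalars ℝ
  let C : Lp ℝ 2 (surfaceMeasure Ω) →L[ℝ] Lp ℂ 2 (surfaceMeasure Ω) :=
    Complex.ofRealCLM.compLpL 2 (surfaceMeasure Ω)
  have hC : ∀ (g : Euc d → ℝ) (h : MemLp g 2 (surfaceMeasure Ω)),
      C h.toLp =ᵐ[surfaceMeasure Ω] fun x => (g x : ℂ) := fun g h => by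
    filter_upwards [Complex.ofRealCLM.coeFn_compLpL h.toLp, h.coeFn_toLp] with x hx hx'
    rw [hx, hx']
    rfl
  refine ⟨S', (Complex.I • B).restrictScalars ℝ ∘L C, B.restrictScalars ℝ ∘L C,
    S' ∘L lTwoIm Ω ∘L (h1ToLTwo ℂ Ω).restrictScalars ℝ, fun f F hf g₁ g₂ h₁ h₂ u => ?_,
    fun u w => ?_⟩
  · rw [hSB f _ F (Complex.I • C h₁.toLp + C h₂.toLp) hf ?_ u]
    · have : S F + B (Complex.I • C h₁.toLp + C h₂.toLp)
          = S' F + (((Complex.I • B).restrictScalars ℝ ∘L C) h₁.toLp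
            + (B.restrictScalars ℝ ∘L C) h₂.toLp) := by
        rw [map_add, map_smul]
        rfl
      rw [this]
    · filter_upwards [Lp.coeFn_add (Complex.I • C h₁.toLp) (C h₂.toLp),
        Lp.coeFn_smul Complex.I (C h₁.toLp), hC g₁ h₁, hC g₂ h₂] with x e1 e2 e3 e4
      rw [e1, Pi.add_apply, e2, Pi.smul_apply, e3, e4, smul_eq_mul, add_comm]
  · rw [hSB _ (fun _ => 0) (lTwoIm Ω (h1ToLTwo ℂ Ω u)) 0 ?_ (Lp.coeFn_zero _ _ _).symm w, map_zero,
      add_zero]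
    · rfl
    · exact ((Complex.ofRealCLM ∘L Complex.imCLM).coeFn_compLpL (h1ToLTwo ℂ Ω u)).symm

/-- The coupled system is well posed as soon as it is equivalent to a reduced system whose
inhomogeneity depends linearly and continuously on the boundary data. -/
theorem systemWellPosed_of_reduced {d : ℕ} {Ω Ω₀ : Set (Euc d)}
    [IsFiniteMeasure (surfaceMeasure Ω)] {η : ℝ → ℝ} (hη : ContinuousOn η (Ici 0))
    {P : Type*} [NormedAddCommGroup P] [NormedSpace ℝ P] [CompleteSpace P] {val : P → Euc d → ℝ}
    (S : P →L[ℝ] SobolevH1 ℂ Ω) (W : SobolevH1 ℂ Ω →L[ℝ] SobolevH1 ℂ Ω)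
    (R : SobolevH1 ℂ Ω →L[ℝ] P) (B₁ B₂ : Lp ℝ 2 (surfaceMeasure Ω) →L[ℝ] SobolevH1 ℂ Ω)
    (hred : ∀ {g₁ g₂ : Euc d → ℝ} (h₁ : MemLp g₁ 2 (surfaceMeasure Ω))
      (h₂ : MemLp g₂ 2 (surfaceMeasure Ω)) (p₀ v₀ : P) (p v : ℝ → P) (u w : ℝ → SobolevH1 ℂ Ω),
      IsGlobalWeakSolution val Ω Ω₀ η g₁ g₂ p₀ v₀ p v u w ↔
        IsReducedSolution η S W R (B₁ h₁.toLp + B₂ h₂.toLp) p₀ v₀ p v u w) :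
    SystemWellPosed val Ω Ω₀ η := by
  intro p₀ v₀ g₁ g₂ hg₁ hg₂
  have hg₁' := hg₁.mono_exponent (q := ⊤) (p := 2) le_top
  have hg₂' := hg₂.mono_exponent (q := ⊤) (p := 2) le_top
  refine ⟨?_, fun T _ ε hε => ?_⟩
  · obtain ⟨p, v, u, w, h⟩ := IsReducedSolution.exists_of_continuousOn hη S W R
      (B₁ hg₁'.toLp + B₂ hg₂'.toLp) p₀ v₀
    exact ⟨p, v, u, w, (hred hg₁' hg₂' _ _ _ _ _ _).2 h, fun p' v' u' w' h' =>
      h.unique hη ((hred hg₁' hg₂' _ _ _ _ _ _).1 h')⟩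
  · obtain ⟨c, hc0, hc⟩ := IsReducedSolution.exists_norm_sub_le hη S W R T
    -- Dividing by `m + 1` covers `m = 0` and makes `m * δ < ε` strict.
    let m : ℝ := c * (‖B₁‖ + ‖B₂‖)
    have hm : 0 ≤ m := by positivity
    have hδ : 0 < ε / (m + 1) := by positivity
    set δ := ε / (m + 1) with hδ_def
    have hlt : m * δ < ε := by
      have : (m + 1) * δ = ε := by rw [hδ_def]; field_simp
      linarith
    refine ⟨δ, hδ, fun h₁ h₂ hh₁ hh₂ hd₁ hd₂ p v p' v' u w u' w' hsol hsol' => ?_⟩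
    have hh₁' := hh₁.mono_exponent (q := ⊤) (p := 2) le_top
    have hh₂' := hh₂.mono_exponent (q := ⊤) (p := 2) le_top
    have hnorm : ∀ {f g : Euc d → ℝ} (hf : MemLp f 2 (surfaceMeasure Ω))
        (hg : MemLp g 2 (surfaceMeasure Ω)),
        eLpNorm (fun x => f x - g x) 2 (surfaceMeasure Ω) < ENNReal.ofReal δ →
        ‖hf.toLp - hg.toLp‖ ≤ δ := fun hf hg h => by
      rw [← MemLp.toLp_sub, Lp.norm_toLp]
      exact ENNReal.toReal_le_of_le_ofReal hδ.le h.le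
    have hb : ‖B₁ hh₁'.toLp + B₂ hh₂'.toLp - (B₁ hg₁'.toLp + B₂ hg₂'.toLp)‖
        ≤ (‖B₁‖ + ‖B₂‖) * δ := by
      rw [add_sub_add_comm, ← map_sub, ← map_sub, add_mul]
      exact (norm_add_le _ _).trans (add_le_add
        (B₁.le_opNorm_of_le (hnorm hh₁' hg₁' hd₁)) (B₂.le_opNorm_of_le (hnorm hh₂' hg₂' hd₂)))
    have hcb := (mul_le_mul_of_nonneg_left hb hc0).trans_lt (by rwa [← mul_assoc])
    obtain ⟨hpv, huw⟩ := hc _ _ _ _ _ _ _ _ _ _ _ _ ((hred hg₁' hg₂' _ _ _ _ _ _).1 hsol)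
      ((hred hh₁' hh₂' _ _ _ _ _ _).1 hsol')
    exact ⟨fun t ht => ⟨(hpv t ht).1.trans_lt hcb, (hpv t ht).2.trans_lt hcb⟩,
      fun t ht => ⟨(huw t ht).1.trans_lt hcb, (huw t ht).2.trans_lt hcb⟩⟩

/-- The coupled system is well posed for every complete source space `P` whose elements extend by
zero to `L²(Ω)`, to which the imaginary parts of the functions of `H¹(Ω)` restrict, and whose
elements are determined by the underlying functions. -/
theorem IsSmoothBoundedDomain.systemWellPosed {d : ℕ} {Ω Ω₀ : Set (Euc d)}
    (hΩ : IsSmoothBoundedDomain Ω) {η : ℝ → ℝ} (hη : ContinuousOn η (Ici 0))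
    {P : Type*} [NormedAddCommGroup P] [NormedSpace ℝ P] [CompleteSpace P] {val : P → Euc d → ℝ}
    (J : P →L[ℝ] LTwo ℂ Ω)
    (hJ : ∀ p, (Ω₀.indicator fun x => ((val p x : ℝ) : ℂ)) =ᵐ[volume.restrict Ω] J p)
    (R : SobolevH1 ℂ Ω →L[ℝ] P)
    (hR : ∀ (a v : P) (c : ℝ) (w : SobolevH1 ℂ Ω),
      (∀ᵐ x ∂((volume : Measure (Euc d)).restrict Ω₀),
        val a x + c * val v x + (h1Val w x).im = 0) ↔ a + c • v + R w = 0) :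
    SystemWellPosed val Ω Ω₀ η := by
  have := hΩ.isFiniteMeasure_surfaceMeasure
  obtain ⟨S₀, B₁, B₂, W, hstate, hadj⟩ := hΩ.exists_state_adjoint_operators
  refine systemWellPosed_of_reduced hη (S₀ ∘L J) W R B₁ B₂ fun {g₁ g₂} h₁ h₂ p₀ v₀ p v u w => ?_
  have hst : ∀ t, IsWeakRobinSolution Ω (Ω₀.indicator fun x => ((val (p t) x : ℝ) : ℂ))
      (fun x => (g₂ x : ℂ) + Complex.I * (g₁ x : ℂ)) (u t) ↔
      u t = S₀ (J (p t)) + (B₁ h₁.toLp + B₂ h₂.toLp) :=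
    fun t => hstate _ (J (p t)) (hJ (p t)) g₁ g₂ h₁ h₂ (u t)
  generalize B₁ h₁.toLp + B₂ h₂.toLp = b at hst ⊢
  -- Elimination of `u` and `w`: the force in the evolution equation becomes `K p + k`.
  have hforce : ∀ t, u t = S₀ (J (p t)) + b → w t = W (u t) →
      R (w t) = (R ∘L W ∘L S₀ ∘L J) (p t) + R (W b) := fun t hu hw => by
    rw [hw, hu, map_add, map_add]
    rfl
  constructor
  · intro h
    have hu : ∀ t ∈ Ioi (0 : ℝ), u t = S₀ (J (p t)) + b := fun t ht => (hst t).1 (h.state t ht)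
    have hw : ∀ t ∈ Ioi (0 : ℝ), w t = W (u t) := fun t ht => (hadj _ _).1 (h.adjoint t ht)
    refine ⟨⟨h.hasDeriv, h.continuous_velocity, h.initial_position, h.initial_velocity,
      fun t ht => ?_⟩, hu, hw⟩
    -- By `hR` the a.e. identity is an identity in `P`, which determines the acceleration `a`.
    obtain ⟨a, ha, hax⟩ := h.evolution t ht
    rw [hR, hforce t (hu t ht) (hw t ht)] at hax
    convert ha using 1
    rw [eq_comm, ← sub_eq_zero, ← hax]
    abel
  · intro h
    refine ⟨h.damped.hasDeriv, h.damped.continuous_velocity, h.damped.initial_position,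
      h.damped.initial_velocity, fun t ht => ⟨_, h.damped.evolution t ht, ?_⟩,
      fun t ht => (hadj _ _).2 (h.adjoint t ht), fun t ht => (hst t).2 (h.state t ht)⟩
    rw [hR, hforce t (h.state t ht) (h.adjoint t ht)]
    abel

/-! ### Transfer between `Ω` and `Ω₀` -/

theorem exists_restrict_im {d : ℕ} {Ω Ω₀ : Set (Euc d)} (hsub : Ω₀ ⊆ Ω) :
    ∃ q : LTwo ℂ Ω →L[ℝ] LTwo ℝ Ω₀, ∀ f, q f =ᵐ[volume.restrict Ω₀] fun x => (f x).im := by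
  have e : ((volume : Measure (Euc d)).restrict Ω).restrict Ω₀ = volume.restrict Ω₀ :=
    Measure.restrict_restrict_of_subset hsub
  -- A variable measure `ν` lets the equality `e` be substituted, with no transport between `Lp`
  -- spaces.
  have hr : ∀ ν : Measure (Euc d), ((volume : Measure (Euc d)).restrict Ω).restrict Ω₀ = ν →
      ∃ q : LTwo ℂ Ω →L[ℝ] Lp ℝ 2 ν, ∀ f, q f =ᵐ[ν] fun x => (f x).im := by
    rintro ν rfl
    refine ⟨Complex.imCLM.compLpL 2 _ ∘L
      LpToLpRestrictCLM (Euc d) ℂ ℝ (volume.restrict Ω) 2 Ω₀, fun f => ?_⟩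
    filter_upwards [Complex.imCLM.coeFn_compLpL
      (LpToLpRestrictCLM (Euc d) ℂ ℝ (volume.restrict Ω) 2 Ω₀ f),
      LpToLpRestrictCLM_coeFn ℝ Ω₀ f] with x h1 h2
    rw [ContinuousLinearMap.comp_apply, h1, h2]
    rfl
  exact hr _ e

/-- Extension by zero preserves the `L²` norm, hence the operator bound `1`. -/
theorem exists_extendByZero {d : ℕ} {Ω Ω₀ : Set (Euc d)} (hΩ₀ : IsOpen Ω₀) (hsub : Ω₀ ⊆ Ω) :
    ∃ J : LTwo ℝ Ω₀ →L[ℝ] LTwo ℂ Ω, ∀ f : LTwo ℝ Ω₀,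
      (Ω₀.indicator fun x => ((f x : ℝ) : ℂ)) =ᵐ[volume.restrict Ω] J f := by
  have e : ((volume : Measure (Euc d)).restrict Ω).restrict Ω₀ = volume.restrict Ω₀ :=
    Measure.restrict_restrict_of_subset hsub
  have hmem : ∀ f : LTwo ℝ Ω₀,
      MemLp (Ω₀.indicator fun x => ((f x : ℝ) : ℂ)) 2 (volume.restrict Ω) := fun f => by
    rw [memLp_indicator_iff_restrict hΩ₀.measurableSet, e]
    exact (Lp.memLp f).ofReal
  have hae : ∀ {P : Euc d → Prop}, (∀ᵐ x ∂(volume.restrict Ω₀), P x) →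
      ∀ᵐ x ∂(volume.restrict Ω), x ∈ Ω₀ → P x := fun h => by
    rw [← e] at h
    exact (ae_restrict_iff' hΩ₀.measurableSet).1 h
  let J : LTwo ℝ Ω₀ →ₗ[ℝ] LTwo ℂ Ω :=
    { toFun := fun f => (hmem f).toLp
      map_add' := fun f g => by
        rw [← MemLp.toLp_add, MemLp.toLp_eq_toLp_iff]
        filter_upwards [hae (Lp.coeFn_add f g)] with x hx
        by_cases h : x ∈ Ω₀
        · rw [indicator_of_mem h, Pi.add_apply, indicator_of_mem h, indicator_of_mem h, hx h,
            Pi.add_apply, Complex.ofReal_add]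
        · simp [h]
      map_smul' := fun c f => by
        rw [RingHom.id_apply, ← MemLp.toLp_const_smul, MemLp.toLp_eq_toLp_iff]
        filter_upwards [hae (Lp.coeFn_smul c f)] with x hx
        by_cases h : x ∈ Ω₀
        · simp [h, hx h]
        · simp [h] }
  refine ⟨J.mkContinuous 1 fun f => ?_, fun f => (hmem f).coeFn_toLp.symm⟩
  change ‖(hmem f).toLp‖ ≤ _
  rw [Lp.norm_toLp, eLpNorm_indicator_eq_eLpNorm_restrict hΩ₀.measurableSet, e, one_mul,
    Lp.norm_def]
  refine le_of_eq (congrArg _ (eLpNorm_congr_norm_ae (Eventually.of_forall fun x => ?_)))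
  simp

/-- The imaginary part of a weak partial derivative is a weak partial derivative, also on a
smaller open set. -/
theorem IsWeakPartial.im_restrict {d : ℕ} {Ω Ω₀ : Set (Euc d)} (hΩ : MeasurableSet Ω)
    (hsub : Ω₀ ⊆ Ω) {i : Fin d} {u v : LTwo ℂ Ω} (h : IsWeakPartial Ω i u v) {u₀ v₀ : Euc d → ℝ}
    (hu : u₀ =ᵐ[volume.restrict Ω₀] fun x => (u x).im)
    (hv : v₀ =ᵐ[volume.restrict Ω₀] fun x => (v x).im) : IsWeakPartial Ω₀ i u₀ v₀ := by
  intro φ hφ hc hs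
  have key : ∀ ψ : Euc d → ℝ, Continuous ψ → HasCompactSupport ψ → tsupport ψ ⊆ Ω₀ →
      ∀ (w : LTwo ℂ Ω) (w₀ : Euc d → ℝ), (w₀ =ᵐ[volume.restrict Ω₀] fun x => (w x).im) →
      ∫ x in Ω₀, ((ψ x : ℝ) : ℝ) * w₀ x = (∫ x in Ω, ((ψ x : ℝ) : ℂ) * w x).im := by
    intro ψ h1 h2 h3 w w₀ hw
    have e1 : ∫ x in Ω₀, ψ x * w₀ x = ∫ x in Ω₀, ψ x * (w x).im := by
      refine integral_congr_ae ?_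
      filter_upwards [hw] with x hx
      rw [hx]
    have e2 : ∫ x in Ω₀, ψ x * (w x).im = ∫ x in Ω, ψ x * (w x).im := by
      refine (setIntegral_eq_of_subset_of_forall_sdiff_eq_zero hΩ hsub fun x hx => ?_).symm
      rw [image_eq_zero_of_notMem_tsupport (fun hx' => hx.2 (h3 hx')), zero_mul]
    have e3 := Complex.imCLM.integral_comp_comm (integrable_ofReal_mul_lTwo Ω ψ h1 h2 w)
    refine (e1.trans e2).trans (Eq.trans ?_ e3)
    refine integral_congr_ae (Eventually.of_forall fun x => ?_)
    exact (Complex.im_ofReal_mul _ _).symm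
  -- The derivative of a test function vanishes off the support of that function, so both integrals
  -- in the identity may be taken over `Ω` instead of `Ω₀`.
  have hs' : tsupport (classicalPartial i φ) ⊆ Ω₀ :=
    (closure_minimal (fun x hx => by
      by_contra hx'
      refine hx ?_
      unfold classicalPartial
      rw [fderiv_of_notMem_tsupport ℝ hx']
      rfl) (isClosed_tsupport φ)).trans hs
  have k1 := key _ (continuous_classicalPartial i hφ) (hasCompactSupport_classicalPartial i hc) hs'
    u u₀ hu
  have k2 := key φ hφ.continuous hc hs v v₀ hv
  have k3 := h φ hφ hc (hs.trans hsub)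
  refine k1.trans ((congrArg Complex.im k3).trans ?_)
  rw [Complex.neg_im]
  exact congrArg Neg.neg k2.symm

/-- A weak partial derivative of zero on an open set vanishes. -/
theorem IsWeakPartial.eq_zero_of_zero {d : ℕ} {𝕜 : Type*} [RCLike 𝕜] {G : Set (Euc d)}
    (hG : IsOpen G) {i : Fin d} {v : LTwo 𝕜 G} (h : IsWeakPartial G i ((0 : LTwo 𝕜 G)) v) :
    v = 0 := by
  rw [Lp.eq_zero_iff_ae_eq_zero]
  have hloc : LocallyIntegrableOn v G volume :=
    locallyIntegrableOn_of_locallyIntegrable_restrict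
      ((Lp.memLp v).locallyIntegrable (by norm_num))
  -- The fundamental lemma of the calculus of variations on the open set `G`.
  refine (ae_restrict_iff' hG.measurableSet).2
    (hG.ae_eq_zero_of_integral_contDiff_smul_eq_zero hloc fun φ hφ hc hs => ?_)
  have h1 := h φ hφ hc hs
  have h2 : ∫ x in G, ((classicalPartial i φ x : ℝ) : 𝕜) * ((0 : LTwo 𝕜 G) : Euc d → 𝕜) x = 0 := by
    refine integral_eq_zero_of_ae ?_
    filter_upwards [Lp.coeFn_zero 𝕜 2 ((volume : Measure (Euc d)).restrict G)] with x hx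
    rw [hx, Pi.zero_apply, mul_zero]
  rw [h2, eq_comm, neg_eq_zero] at h1
  rw [← h1, ← setIntegral_eq_integral_of_forall_compl_eq_zero (s := G)]
  · simp only [RCLike.real_smul_eq_coe_mul]
  · intro x hx
    rw [image_eq_zero_of_notMem_tsupport (fun hx' => hx (hs hx')), zero_smul]

/-- Weak derivatives are determined by the function, so the stored gradient carries no extra
freedom. Equations in `H¹` can therefore be verified in `L²`. -/
theorem h1ToLTwo_injective {d : ℕ} {𝕜 : Type*} [RCLike 𝕜] {G : Set (Euc d)} (hG : IsOpen G) :
    Function.Injective (h1ToLTwo 𝕜 G) := by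
  refine (injective_iff_map_eq_zero _).2 fun u hu => ?_
  have hu0 : u.1.fst = 0 := hu
  have hs : ∀ i, u.1.snd i = 0 := fun i => by
    have := u.2 i
    rw [hu0] at this
    exact this.eq_zero_of_zero hG
  refine Subtype.ext ((WithLp.ofLp_injective 2) (Prod.ext hu0 ?_))
  exact PiLp.ext hs

/-- The weak partial derivative as a bounded operator from `H¹(G)` to `L²(G)`. -/
noncomputable def h1PartialCLM {d : ℕ} (𝕜 : Type*) [RCLike 𝕜] (G : Set (Euc d)) (i : Fin d) :
    SobolevH1 𝕜 G →L[𝕜] LTwo 𝕜 G :=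
  PiLp.proj (𝕜 := 𝕜) 2 (fun _ : Fin d => LTwo 𝕜 G) i ∘L WithLp.sndL 2 𝕜 _ _ ∘L
    (SobolevH1 𝕜 G).subtypeL

/-- Applying `q` to the function and to each weak derivative gives a jet whose entries still satisfy
the weak derivative identities, on `Ω₀`. -/
theorem exists_restrict_im_sobolevH1 {d : ℕ} {Ω Ω₀ : Set (Euc d)} (hΩ : IsOpen Ω)
    (hsub : Ω₀ ⊆ Ω) (q : LTwo ℂ Ω →L[ℝ] LTwo ℝ Ω₀)
    (hq : ∀ f, q f =ᵐ[volume.restrict Ω₀] fun x => (f x).im) :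
    ∃ R : SobolevH1 ℂ Ω →L[ℝ] SobolevH1 ℝ Ω₀, ∀ w,
      h1ToLTwo ℝ Ω₀ (R w) = q (h1ToLTwo ℂ Ω w) := by
  let D : SobolevH1 ℂ Ω →L[ℝ] PiLp 2 (fun _ : Fin d => LTwo ℝ Ω₀) :=
    ((PiLp.continuousLinearEquiv 2 ℝ (fun _ : Fin d => LTwo ℝ Ω₀)).symm :
      (Fin d → LTwo ℝ Ω₀) →L[ℝ] PiLp 2 (fun _ : Fin d => LTwo ℝ Ω₀)) ∘L
      ContinuousLinearMap.pi fun i => q ∘L (h1PartialCLM ℂ Ω i).restrictScalars ℝ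
  let R₀ : SobolevH1 ℂ Ω →L[ℝ] LTwoJet ℝ Ω₀ :=
    ((WithLp.prodContinuousLinearEquiv 2 ℝ (LTwo ℝ Ω₀)
      (PiLp 2 (fun _ : Fin d => LTwo ℝ Ω₀))).symm :
      LTwo ℝ Ω₀ × PiLp 2 (fun _ : Fin d => LTwo ℝ Ω₀) →L[ℝ] LTwoJet ℝ Ω₀) ∘L
      ((q ∘L (h1ToLTwo ℂ Ω).restrictScalars ℝ).prod D)
  refine ⟨R₀.codRestrict (SobolevH1 ℝ Ω₀) fun w i => ?_, fun w => rfl⟩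
  exact IsWeakPartial.im_restrict hΩ.measurableSet hsub (w.2 i) (hq _) (hq _)

theorem ae_add_mul_add_im_eq_zero_iff {d : ℕ} {Ω Ω₀ : Set (Euc d)} {q : LTwo ℂ Ω →L[ℝ] LTwo ℝ Ω₀}
    (hq : ∀ f, q f =ᵐ[volume.restrict Ω₀] fun x => (f x).im) (a v : LTwo ℝ Ω₀) (c : ℝ)
    (w : SobolevH1 ℂ Ω) :
    (∀ᵐ x ∂((volume : Measure (Euc d)).restrict Ω₀), a x + c * v x + (h1Val w x).im = 0) ↔
      a + c • v + q (h1ToLTwo ℂ Ω w) = 0 := by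
  rw [Lp.eq_zero_iff_ae_eq_zero]
  refine eventually_congr ?_
  filter_upwards [Lp.coeFn_add (a + c • v) (q (h1ToLTwo ℂ Ω w)), Lp.coeFn_add a (c • v),
    Lp.coeFn_smul c v, hq (h1ToLTwo ℂ Ω w)] with x e1 e2 e3 e4
  rw [e1, Pi.add_apply, e2, Pi.add_apply, e3, e4]
  rfl

theorem theorem2p1 {d : ℕ} (hd : d = 2 ∨ d = 3) (Ω Ω₀ : Set (Euc d))
    (hΩ : IsSmoothBoundedDomain Ω) (hΩ₀ : IsOpen Ω₀) (hsub : Ω₀ ⊆ Ω)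
    (η : ℝ → ℝ) (hη : ContinuousOn η (Set.Ici 0)) (hηpos : ∀ t ∈ Set.Ici (0 : ℝ), 0 < η t) :
    SystemWellPosed (P := LTwo ℝ Ω₀) (fun p => (p : Euc d → ℝ)) Ω Ω₀ η ∧
    SystemWellPosed (P := SobolevH1 ℝ Ω₀) (fun p => h1Val p) Ω Ω₀ η := by
  obtain ⟨J, hJ⟩ := exists_extendByZero hΩ₀ hsub
  obtain ⟨q, hq⟩ := exists_restrict_im hsub
  obtain ⟨R, hR⟩ := exists_restrict_im_sobolevH1 hΩ.isOpen hsub q hq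
  refine ⟨hΩ.systemWellPosed hη J hJ (q ∘L (h1ToLTwo ℂ Ω).restrictScalars ℝ)
    (ae_add_mul_add_im_eq_zero_iff hq), hΩ.systemWellPosed hη (J ∘L h1ToLTwo ℝ Ω₀)
    (fun p => hJ (h1ToLTwo ℝ Ω₀ p)) R fun a v c w => ?_⟩
  -- For `P = H¹(Ω₀)` the evolution identity is pulled back to `L²(Ω₀)` by injectivity, where it is
  -- the a.e. equation.
  rw [← (h1ToLTwo_injective (𝕜 := ℝ) hΩ₀).eq_iff, map_zero, map_add, map_add, map_smul, hR]
  exact ae_add_mul_add_im_eq_zero_iff hq (h1ToLTwo ℝ Ω₀ a) (h1ToLTwo ℝ Ω₀ v) c w
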